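/- Conventions. Fix a commutative ring $\mathbb K$; modules, algebras, $\otimes$ are over $\mathbb K$. Algebras are associative and not necessarily unital. A graded algebra is $A=\bigoplus_{p\in\mathbb Z}A^p$ with $A^pA^q\subset A^{p+q}$; for homogeneous $a$ put $|a|_n=|a|+n$. A graded algebra is commutative if $xy=(-1)^{|x||y|}yx$ for homogeneous $x,y$. A coalgebra is a module $M$ with a coassociative linear map $\mu:M\to M\otimes M$, written $\mu(\alpha)=\alpha^1\otimes\alpha^2$ (and $\beta^1\otimes\beta^2\otimes\beta^3$ for the iterated comultiplication of $\beta$); no counit is required. Brackets. An $n$-graded biderivation in a graded algebra $B$ is a bilinear map $\{-,-\}:B\times B\to B$ with $\{B^p,B^q\}\subset B^{p+q+n}$ such that for homogeneous $a,b,c$: $\{a,bc\}=\{a,b\}c+(-1)^{|a|_n|b|}b\{a,c\}$, $\{ab,c\}=a\{b,c\}+(-1)^{|b||c|_n}\{a,c\}b$, $\{a,b\}=-(-1)^{|a|_n|b|_n}\{b,a\}$. It is an $n$-graded Gerstenhaber bracket if moreover $(-1)^{|a|_n|c|_n}\{a,\{b,c\}\}+(-1)^{|b|_n|a|_n}\{b,\{c,a\}\}+(-1)^{|c|_n|b|_n}\{c,\{a,b\}\}=0$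 for homogeneous $a,b,c$. A Poisson bracket in a non-graded algebra is a bilinear map satisfying these identities with all degrees and $n$ equal to $0$. Double brackets. Let $P_{21,n}(a\otimes b)=(-1)^{|a|_n|b|_n}b\otimes a$, $P_{312,n}(a\otimes b\otimes c)=(-1)^{|c|_n(|a|_n+|b|_n)}c\otimes a\otimes b$ for homogeneous $a,b,c\in A$, and $P_{21}=P_{21,0}$, $P_{312}=P_{312,0}$. Put $a(x\otimes y)b=ax\otimes yb$ and, for homogeneous elements, $a*(x\otimes y)=(-1)^{|a||x|}x\otimes ay$, $(x\otimes y)*b=(-1)^{|b||y|}xb\otimes y$. An $n$-graded double bracket in $A$ is a linear map $\{\!\{-,-\}\!\}:A\otimes A\to A\otimes A$ with $\{\!\{A^p,A^q\}\!\}\subset\bigoplus_{i+j=p+q+n}A^i\otimes A^j$, with $\{\!\{-,-\}\!\}P_{21,n}=-P_{21}\{\!\{-,-\}\!\}$, and with $\{\!\{a,bc\}\!\}=\{\!\{a,b\}\!\}c+(-1)^{|a|_n|b|}b\{\!\{a,c\}\!\}$ and $\{\!\{ab,c\}\!\}=a*\{\!\{b,c\}\!\}+(-1)^{|b||c|_n}\{\!\{a,c\}\!\}*b$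 for homogeneous $a,b,c$. It is a double Gerstenhaber bracket if $$\sum_{i=0}^{2}P_{312}^{\,i}\,(\{\!\{-,-\}\!\}\otimes\mathrm{id}_A)(\mathrm{id}_A\otimes\{\!\{-,-\}\!\})\,P_{312,n}^{-i}=0 .$$ For $A$ concentrated in degree $0$ and $n=0$ it is then called a double Poisson bracket. Cyclic forms. For a bilinear form $v:M\otimes M\to\mathbb K$ let $\widehat v(\alpha\otimes\beta)=v(\alpha\otimes\beta^2)\,\beta^1\otimes\beta^3$. The form $v$ is cyclic if $\widehat v$ commutes with the flip of $M\otimes M$. Representation algebra. For a graded algebra $A$ and a coalgebra $M$, let $A_M$ be the (non-unital) algebra with generators $a_\alpha$ ($a\in A$, $\alpha\in M$), bilinear in $(a,\alpha)$, subject to the relations $(ab)_\alpha=a_{\alpha^1}b_{\alpha^2}$, and $a_\alpha b_\beta=(-1)^{|a||b|}b_\beta a_\alpha$ for homogeneous $a,b$; $a_\alpha$ has degree $|a|$ for homogeneous $a$. Theorem. Let $n\in\mathbb Z$, let $\{\!\{-,-\}\!\}$ be an $n$-graded double bracket in a graded algebra $A$, and let $v$ be a cyclic bilinear form on a coalgebra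 $M$. (1) $A_M$ is a commutative graded algebra, and there is a unique $n$-graded biderivation $\{-,-\}_v$ in $A_M$ such that for all $a,b\in A$, $\alpha,\beta\in M$ $$\{a_\alpha,b_\beta\}_v=\sum_{i,j}(x_i)_{\alpha_j}(y_i)_{\beta_j},\qquad \{\!\{a,b\}\!\}=\sum_i x_i\otimes y_i,\quad \widehat v(\alpha\otimes\beta)=\sum_j\alpha_j\otimes\beta_j .$$ (2) If $\{\!\{-,-\}\!\}$ is an $n$-graded double Gerstenhaber bracket, then $\{-,-\}_v$ is an $n$-graded Gerstenhaber bracket. (3) If $A$ is non-graded (concentrated in degree $0$), $n=0$ and $\{\!\{-,-\}\!\}$ is a double Poisson bracket, then $A_M$ is commutative in the ordinary sense and there is a unique Poisson bracket in $A_M$ given on the generators by the formula in (1). (4) Let $N\ge1$, and let $M=\mathrm{Mat}_N(\mathbb K)^*$ with comultiplication $\tau_{i,j}\mapsto\sum_r\tau_{i,r}\otimes\tau_{r,j}$, where $\tau_{i,j}$ is the functional taking the $(i,j)$ entry, and let $v(\tau_{i,j}\otimes\tau_{k,l})=\delta_{il}\delta_{jk}$. Then $M$ is a coalgebra, $v$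 is cyclic, and, writing $a_{i,j}=a_{\tau_{i,j}}$, the formula in (1) for a bilinear bracket in $A_M$ is equivalent to Van den Bergh's formula $\{a_{i,j},b_{k,l}\}=\sum_s (x_s)_{k,j}(y_s)_{i,l}$ for $\{\!\{a,b\}\!\}=\sum_s x_s\otimes y_s$. If $A$ is non-graded, then $A_M$ is the algebra $A_N$: $a\mapsto(a_{i,j})_{i,j}$ is an algebra homomorphism $t:A\to\mathrm{Mat}_N(A_M)$, and for every commutative (not necessarily unital) algebra $B$ and every homomorphism $s:A\to\mathrm{Mat}_N(B)$ there is a unique homomorphism $r:A_M\to B$ with $s=\mathrm{Mat}_N(r)\,t$. -/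

import Mathlib

open scoped TensorProduct

noncomputable section

namespace RepBracket

/-! ### Signed operators on a graded module

Throughout, `𝒜 : ℤ → Submodule K A` is a `ℤ`-grading of `A`, and the `n`-degree of a homogeneous
element `a ∈ 𝒜 p` is `p + n`. Algebras are associative and not assumed to be unital. -/

section Signs

variable {K A : Type*} [CommRing K] [AddCommGroup A] [Module K A]
variable (𝒜 : ℤ → Submodule K A) [DirectSum.Decomposition 𝒜]

/-- The linear map `a ↦ (-1) ^ (p * (|a| + n)) a` (for homogeneous `a`). -/
def signOp (n p : ℤ) : A →ₗ[K] A :=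
  (DirectSum.toModule K ℤ A fun q => (p * (q + n)).negOnePow • (𝒜 q).subtype) ∘ₗ
    (DirectSum.decomposeLinearEquiv 𝒜).toLinearMap

theorem signOp_of_mem {n p q : ℤ} {a : A} (ha : a ∈ 𝒜 q) :
    signOp 𝒜 n p a = (p * (q + n)).negOnePow • a := by
  lift a to 𝒜 q using ha
  simp only [signOp, LinearMap.comp_apply, LinearEquiv.coe_coe,
    DirectSum.decomposeLinearEquiv_apply, DirectSum.decompose_coe]
  erw [DirectSum.toModule_lof]
  rfl

/-- The `n`-graded flip `P_{21,n}`, as a linear map; see `swapMap_tmul`. -/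
def swapMap (n : ℤ) : A ⊗[K] A →ₗ[K] A ⊗[K] A :=
  TensorProduct.lift
    ((DirectSum.toModule K ℤ (A →ₗ[K] A ⊗[K] A) fun p =>
        LinearMap.lcomp K (A ⊗[K] A) (signOp 𝒜 n (p + n)) ∘ₗ
          (TensorProduct.mk K A A).flip ∘ₗ (𝒜 p).subtype) ∘ₗ
      (DirectSum.decomposeLinearEquiv 𝒜).toLinearMap)

theorem swapMap_tmul {n p q : ℤ} {a b : A} (ha : a ∈ 𝒜 p) (hb : b ∈ 𝒜 q) :
    swapMap 𝒜 n (a ⊗ₜ b) = ((p + n) * (q + n)).negOnePow • (b ⊗ₜ[K] a) := by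
  lift a to 𝒜 p using ha
  simp only [swapMap, TensorProduct.lift.tmul, LinearMap.comp_apply, LinearEquiv.coe_coe,
    DirectSum.decomposeLinearEquiv_apply, DirectSum.decompose_coe]
  erw [DirectSum.toModule_lof]
  simp only [LinearMap.comp_apply, LinearMap.lcomp_apply, Submodule.subtype_apply,
    LinearMap.flip_apply, TensorProduct.mk_apply, signOp_of_mem 𝒜 hb]
  rcases Int.units_eq_one_or (((p + n) * (q + n)).negOnePow) with h | h <;>
    simp [h, TensorProduct.neg_tmul]

theorem swapMap_swapMap (n : ℤ) : swapMap 𝒜 n ∘ₗ swapMap 𝒜 n = LinearMap.id := by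
  apply TensorProduct.ext'
  intro a b
  induction a using DirectSum.Decomposition.inductionOn 𝒜 with
  | zero => simp
  | add a a' h h' => simpa [TensorProduct.add_tmul] using congrArg₂ (· + ·) h h'
  | @homogeneous p a =>
    induction b using DirectSum.Decomposition.inductionOn 𝒜 with
    | zero => simp
    | add b b' h h' => simpa [TensorProduct.tmul_add] using congrArg₂ (· + ·) h h'
    | @homogeneous q b =>
      rw [LinearMap.comp_apply, swapMap_tmul 𝒜 a.2 b.2]
      have h := swapMap_tmul 𝒜 (n := n) b.2 a.2
      rw [mul_comm] at h
      rcases Int.units_eq_one_or (((p + n) * (q + n)).negOnePow) with h' | h' <;>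
        simp [h, h']

/-- The `n`-graded flip `P_{21,n}` of `A ⊗ A`. -/
def flip21 (n : ℤ) : A ⊗[K] A ≃ₗ[K] A ⊗[K] A :=
  LinearEquiv.ofLinearMap (swapMap 𝒜 n) (swapMap 𝒜 n) (swapMap_swapMap 𝒜 n) (swapMap_swapMap 𝒜 n)

theorem flip21_tmul {n p q : ℤ} {a b : A} (ha : a ∈ 𝒜 p) (hb : b ∈ 𝒜 q) :
    flip21 𝒜 n (a ⊗ₜ b) = ((p + n) * (q + n)).negOnePow • (b ⊗ₜ[K] a) :=
  swapMap_tmul 𝒜 ha hb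

/-- The `n`-graded permutation `P_{312,n}` of `A ⊗ A ⊗ A`; see `perm312_tmul`. -/
def perm312 (n : ℤ) : A ⊗[K] (A ⊗[K] A) ≃ₗ[K] A ⊗[K] (A ⊗[K] A) :=
  TensorProduct.congr (LinearEquiv.refl K A) (flip21 𝒜 n) ≪≫ₗ
    (TensorProduct.assoc K A A A).symm ≪≫ₗ
    TensorProduct.congr (flip21 𝒜 n) (LinearEquiv.refl K A) ≪≫ₗ
    TensorProduct.assoc K A A A

theorem perm312_tmul {n p q r : ℤ} {a b c : A} (ha : a ∈ 𝒜 p) (hb : b ∈ 𝒜 q) (hc : c ∈ 𝒜 r) :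
    perm312 𝒜 n (a ⊗ₜ (b ⊗ₜ c)) =
      ((r + n) * (p + n) + (r + n) * (q + n)).negOnePow • (c ⊗ₜ[K] (a ⊗ₜ[K] b)) := by
  have h1 := flip21_tmul 𝒜 (n := n) hb hc
  have h2 := flip21_tmul 𝒜 (n := n) ha hc
  rw [mul_comm] at h1 h2
  rw [Int.negOnePow_add]
  rcases Int.units_eq_one_or (((r + n) * (p + n)).negOnePow) with h | h <;>
    rcases Int.units_eq_one_or (((r + n) * (q + n)).negOnePow) with h' | h' <;>
    simp [perm312, h1, h2, h, h', TensorProduct.neg_tmul, TensorProduct.tmul_neg]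

end Signs

/-! ### Brackets in graded algebras -/

section Brackets

variable {K B : Type*} [CommRing K] [NonUnitalRing B] [Module K B]

/-- `br` is an `n`-graded biderivation in the graded algebra `B = ⨁ ℬ p`. -/
structure IsBiderivation (ℬ : ℤ → Submodule K B) (n : ℤ) (br : B →ₗ[K] B →ₗ[K] B) : Prop where
  graded : ∀ p q : ℤ, ∀ a ∈ ℬ p, ∀ b ∈ ℬ q, br a b ∈ ℬ (p + q + n)
  leibniz_right : ∀ p q r : ℤ, ∀ a ∈ ℬ p, ∀ b ∈ ℬ q, ∀ c ∈ ℬ r,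
    br a (b * c) = br a b * c + ((p + n) * q).negOnePow • (b * br a c)
  leibniz_left : ∀ p q r : ℤ, ∀ a ∈ ℬ p, ∀ b ∈ ℬ q, ∀ c ∈ ℬ r,
    br (a * b) c = a * br b c + (q * (r + n)).negOnePow • (br a c * b)
  antisymm : ∀ p q : ℤ, ∀ a ∈ ℬ p, ∀ b ∈ ℬ q,
    br a b = -(((p + n) * (q + n)).negOnePow • br b a)

/-- `br` is an `n`-graded Gerstenhaber bracket: a biderivation with vanishing Jacobi form. -/
structure IsGerstenhaber (ℬ : ℤ → Submodule K B) (n : ℤ) (br : B →ₗ[K] B →ₗ[K] B) : Prop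
    extends IsBiderivation ℬ n br where
  jacobi : ∀ p q r : ℤ, ∀ a ∈ ℬ p, ∀ b ∈ ℬ q, ∀ c ∈ ℬ r,
    ((p + n) * (r + n)).negOnePow • br a (br b c) +
      ((q + n) * (p + n)).negOnePow • br b (br c a) +
      ((r + n) * (q + n)).negOnePow • br c (br a b) = 0

/-- `br` is a Poisson bracket in the (non-graded) algebra `B`. -/
structure IsPoisson (br : B →ₗ[K] B →ₗ[K] B) : Prop where
  leibniz_right : ∀ a b c, br a (b * c) = br a b * c + b * br a c
  leibniz_left : ∀ a b c, br (a * b) c = a * br b c + br a c * b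
  antisymm : ∀ a b, br a b = -br b a
  jacobi : ∀ a b c, br a (br b c) + br b (br c a) + br c (br a b) = 0

end Brackets

/-! ### Double brackets -/

section DoubleBrackets

variable {K A : Type*} [CommRing K] [NonUnitalRing A] [Module K A]
  [IsScalarTower K A A] [SMulCommClass K A A]
variable (𝒜 : ℤ → Submodule K A) [DirectSum.Decomposition 𝒜]

/-- The degree `d` part `⨁_{i + j = d} A^i ⊗ A^j` of `A ⊗ A`. -/
def tensorDegree (d : ℤ) : Submodule K (A ⊗[K] A) :=
  Submodule.span K {z | ∃ i j : ℤ, i + j = d ∧ ∃ x ∈ 𝒜 i, ∃ y ∈ 𝒜 j, z = x ⊗ₜ[K] y}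

/-- Left multiplication `x ⊗ y ↦ a x ⊗ y`, for the outer bimodule structure on `A ⊗ A`. -/
def outerL (a : A) : A ⊗[K] A →ₗ[K] A ⊗[K] A :=
  TensorProduct.map (LinearMap.mulLeft K a) LinearMap.id

/-- Right multiplication `x ⊗ y ↦ x ⊗ y b`, for the outer bimodule structure on `A ⊗ A`. -/
def outerR (b : A) : A ⊗[K] A →ₗ[K] A ⊗[K] A :=
  TensorProduct.map LinearMap.id (LinearMap.mulRight K b)

/-- Left multiplication `a * (x ⊗ y) = (-1) ^ (|a| |x|) x ⊗ a y`, for the inner bimodule structure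
on `A ⊗ A`, where `a` is homogeneous of degree `p`. -/
def innerL (p : ℤ) (a : A) : A ⊗[K] A →ₗ[K] A ⊗[K] A :=
  TensorProduct.map (signOp 𝒜 0 p) (LinearMap.mulLeft K a)

/-- Right multiplication `(x ⊗ y) * b = (-1) ^ (|b| |y|) x b ⊗ y`, for the inner bimodule structure
on `A ⊗ A`, where `b` is homogeneous of degree `q`. -/
def innerR (q : ℤ) (b : A) : A ⊗[K] A →ₗ[K] A ⊗[K] A :=
  TensorProduct.map (LinearMap.mulRight K b) (signOp 𝒜 0 q)

/-- `db` is an `n`-graded double bracket in the graded algebra `A = ⨁ 𝒜 p`. -/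
structure IsDoubleBracket (n : ℤ) (db : A ⊗[K] A →ₗ[K] A ⊗[K] A) : Prop where
  graded : ∀ p q : ℤ, ∀ a ∈ 𝒜 p, ∀ b ∈ 𝒜 q, db (a ⊗ₜ b) ∈ tensorDegree 𝒜 (p + q + n)
  antisymm : db ∘ₗ (flip21 𝒜 n).toLinearMap = -((flip21 𝒜 0).toLinearMap ∘ₗ db)
  leibniz_right : ∀ p q r : ℤ, ∀ a ∈ 𝒜 p, ∀ b ∈ 𝒜 q, ∀ c ∈ 𝒜 r,
    db (a ⊗ₜ (b * c)) =
      outerR c (db (a ⊗ₜ b)) + ((p + n) * q).negOnePow • outerL b (db (a ⊗ₜ c))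
  leibniz_left : ∀ p q r : ℤ, ∀ a ∈ 𝒜 p, ∀ b ∈ 𝒜 q, ∀ c ∈ 𝒜 r,
    db ((a * b) ⊗ₜ c) =
      innerL 𝒜 p a (db (b ⊗ₜ c)) + (q * (r + n)).negOnePow • innerR 𝒜 q b (db (a ⊗ₜ c))

/-- The induced tribracket
`∑_{i = 0, 1, 2} P_{312} ^ i ∘ (db ⊗ id) ∘ (id ⊗ db) ∘ P_{312,n} ^ (-i)`. -/
def tribracket (n : ℤ) (db : A ⊗[K] A →ₗ[K] A ⊗[K] A) :
    A ⊗[K] (A ⊗[K] A) →ₗ[K] A ⊗[K] (A ⊗[K] A) :=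
  ∑ i ∈ Finset.range 3,
    (perm312 𝒜 0 ^ i).toLinearMap ∘ₗ
      ((TensorProduct.assoc K A A A).toLinearMap ∘ₗ TensorProduct.map db LinearMap.id ∘ₗ
        (TensorProduct.assoc K A A A).symm.toLinearMap) ∘ₗ
      TensorProduct.map LinearMap.id db ∘ₗ
      (perm312 𝒜 n ^ i).symm.toLinearMap

/-- `db` is an `n`-graded double Gerstenhaber bracket in `A`. If `A` is concentrated in degree zero
and `n = 0`, this is a double Poisson bracket. -/
structure IsDoubleGerstenhaber (n : ℤ) (db : A ⊗[K] A →ₗ[K] A ⊗[K] A) : Prop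
    extends IsDoubleBracket 𝒜 n db where
  tribracket_eq_zero : tribracket 𝒜 n db = 0

end DoubleBrackets

/-! ### Coalgebras (not necessarily counital) and cyclic bilinear forms -/

section Coalgebras

variable {K M : Type*} [CommRing K] [AddCommGroup M] [Module K M]

/-- Coassociativity of a comultiplication `μ`. -/
def IsCoassoc (μ : M →ₗ[K] M ⊗[K] M) : Prop :=
  (TensorProduct.assoc K M M M).toLinearMap ∘ₗ TensorProduct.map μ LinearMap.id ∘ₗ μ =
    TensorProduct.map LinearMap.id μ ∘ₗ μ

/-- The linear map `M ⊗ M → M ⊗ M`, `α ⊗ β ↦ v (α ⊗ β²) β¹ ⊗ β³`. -/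
def vHat (μ : M →ₗ[K] M ⊗[K] M) (v : M ⊗[K] M →ₗ[K] K) : M ⊗[K] M →ₗ[K] M ⊗[K] M :=
  TensorProduct.map LinearMap.id
      ((TensorProduct.lid K M).toLinearMap ∘ₗ TensorProduct.map v LinearMap.id ∘ₗ
        (TensorProduct.assoc K M M M).symm.toLinearMap) ∘ₗ
    (TensorProduct.leftComm K M M (M ⊗[K] M)).toLinearMap ∘ₗ
    TensorProduct.map LinearMap.id (TensorProduct.map LinearMap.id μ ∘ₗ μ)

/-- The bilinear form `v` is cyclic: `vHat` commutes with the flip of `M ⊗ M`. -/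
def IsCyclicForm (μ : M →ₗ[K] M ⊗[K] M) (v : M ⊗[K] M →ₗ[K] K) : Prop :=
  vHat μ v ∘ₗ (TensorProduct.comm K M M).toLinearMap =
    (TensorProduct.comm K M M).toLinearMap ∘ₗ vHat μ v

end Coalgebras

/-! ### The representation algebra -/

section RepresentationAlgebra

variable {K A M : Type*} [CommRing K] [NonUnitalRing A] [Module K A]
  [AddCommGroup M] [Module K M]
variable (𝒜 : ℤ → Submodule K A) (μ : M →ₗ[K] M ⊗[K] M)

/-- The defining relations of the representation algebra, imposed on the tensor algebra of `A ⊗ M`,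
where `a ⊗ α` stands for the generator `a_α`: the multiplicativity relations
`(a b)_α = a_{α¹} b_{α²}` and the graded commutativity relations. -/
inductive RepRel : TensorAlgebra K (A ⊗[K] M) → TensorAlgebra K (A ⊗[K] M) → Prop
  | mul (a b : A) (α : M) :
      RepRel (TensorAlgebra.ι K ((a * b) ⊗ₜ[K] α))
        (LinearMap.mul' K (TensorAlgebra K (A ⊗[K] M))
          (TensorProduct.map (TensorAlgebra.ι K ∘ₗ TensorProduct.mk K A M a)
            (TensorAlgebra.ι K ∘ₗ TensorProduct.mk K A M b) (μ α)))
  | comm (p q : ℤ) (a b : A) (ha : a ∈ 𝒜 p) (hb : b ∈ 𝒜 q) (α β : M) :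
      RepRel (TensorAlgebra.ι K (a ⊗ₜ[K] α) * TensorAlgebra.ι K (b ⊗ₜ[K] β))
        ((p * q).negOnePow •
          (TensorAlgebra.ι K (b ⊗ₜ[K] β) * TensorAlgebra.ι K (a ⊗ₜ[K] α)))

/-- The unital algebra with the generators and relations of the representation algebra, that is,
the representation algebra with a unit adjoined. -/
abbrev RepAlgOne : Type _ := RingQuot (RepRel 𝒜 μ)

/-- The class of `a ⊗ α` in the unital algebra. -/
def genOne : A ⊗[K] M →ₗ[K] RepAlgOne 𝒜 μ :=
  (RingQuot.mkAlgHom K (RepRel 𝒜 μ)).toLinearMap ∘ₗ TensorAlgebra.ι K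

/-- The non-unital subalgebra generated by the generators `a_α`; it consists of the classes of the
polynomials with zero free term in the generators. -/
def repSubalgebra : NonUnitalSubalgebra K (RepAlgOne 𝒜 μ) :=
  NonUnitalAlgebra.adjoin K (Set.range (genOne 𝒜 μ))

/-- The representation algebra `A_M`, without unit. -/
def RepAlg : Type _ := repSubalgebra 𝒜 μ

instance : NonUnitalRing (RepAlg 𝒜 μ) := inferInstanceAs (NonUnitalRing (repSubalgebra 𝒜 μ))

instance : Module K (RepAlg 𝒜 μ) := inferInstanceAs (Module K (repSubalgebra 𝒜 μ))

instance : IsScalarTower K (RepAlg 𝒜 μ) (RepAlg 𝒜 μ) :=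
  inferInstanceAs (IsScalarTower K (repSubalgebra 𝒜 μ) (repSubalgebra 𝒜 μ))

instance : SMulCommClass K (RepAlg 𝒜 μ) (RepAlg 𝒜 μ) :=
  inferInstanceAs (SMulCommClass K (repSubalgebra 𝒜 μ) (repSubalgebra 𝒜 μ))

/-- The linear map `A ⊗ M → A_M`, `a ⊗ α ↦ a_α`. -/
def gen : A ⊗[K] M →ₗ[K] RepAlg 𝒜 μ :=
  (genOne 𝒜 μ).codRestrict (repSubalgebra 𝒜 μ).toSubmodule fun z =>
    NonUnitalAlgebra.subset_adjoin K (Set.mem_range_self z)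

/-- `x` is a product of generators `a_α` with `a` homogeneous, of total degree `p`. -/
inductive IsMonomial : ℤ → RepAlg 𝒜 μ → Prop
  | gen (p : ℤ) (a : A) (ha : a ∈ 𝒜 p) (α : M) : IsMonomial p (gen 𝒜 μ (a ⊗ₜ α))
  | mul (p q : ℤ) (x y : RepAlg 𝒜 μ) (hx : IsMonomial p x) (hy : IsMonomial q y) :
      IsMonomial (p + q) (x * y)

/-- The grading of `A_M` for which `a_α` has degree `|a|`. -/
def repGrading (p : ℤ) : Submodule K (RepAlg 𝒜 μ) :=
  Submodule.span K {x | IsMonomial 𝒜 μ p x}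

/-- The linear map `(A ⊗ A) ⊗ (M ⊗ M) → A_M`, `(x ⊗ y) ⊗ (φ ⊗ ψ) ↦ x_φ y_ψ`. -/
def genMul : (A ⊗[K] A) ⊗[K] (M ⊗[K] M) →ₗ[K] RepAlg 𝒜 μ :=
  LinearMap.mul' K (RepAlg 𝒜 μ) ∘ₗ TensorProduct.map (gen 𝒜 μ) (gen 𝒜 μ) ∘ₗ
    (TensorProduct.tensorTensorTensorComm K A A M M).toLinearMap

/-- The bracket `br` in `A_M` is given on the generators by
`{a_α, b_β} = x_{α_β} y_{β^α}` where `db (a ⊗ b) = x ⊗ y` and `vHat (α ⊗ β) = α_β ⊗ β^α`. -/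
def IsInducedOnGen (v : M ⊗[K] M →ₗ[K] K) (db : A ⊗[K] A →ₗ[K] A ⊗[K] A)
    (br : RepAlg 𝒜 μ →ₗ[K] RepAlg 𝒜 μ →ₗ[K] RepAlg 𝒜 μ) : Prop :=
  ∀ (a b : A) (α β : M), br (gen 𝒜 μ (a ⊗ₜ α)) (gen 𝒜 μ (b ⊗ₜ β)) =
    genMul 𝒜 μ (db (a ⊗ₜ b) ⊗ₜ vHat μ v (α ⊗ₜ β))

end RepresentationAlgebra

/-! ### The coalgebra dual to a matrix algebra -/

section MatrixCoalgebra

variable (K : Type*) [CommRing K] (N : ℕ)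

/-- The module dual to the algebra of `N × N` matrices. -/
abbrev MatDual : Type _ := Module.Dual K (Matrix (Fin N) (Fin N) K)

/-- The functional `τ_{i,j}` carrying a matrix to its `(i, j)` entry. -/
def tau (i j : Fin N) : MatDual K N := Matrix.entryLinearMap K K i j

/-- The evaluation of functionals at the elementary matrix `E_{i,j}`. -/
def evalE (i j : Fin N) : MatDual K N →ₗ[K] K :=
  Module.Dual.eval K (Matrix (Fin N) (Fin N) K) (Matrix.single i j 1)

theorem evalE_tau (i j k l : Fin N) :
    evalE K N i j (tau K N k l) = if i = k ∧ j = l then 1 else 0 := by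
  simp [evalE, tau, Matrix.single_apply]

/-- The comultiplication dual to matrix multiplication: `τ_{i,j} ↦ ∑_r τ_{i,r} ⊗ τ_{r,j}`. -/
def matComul : MatDual K N →ₗ[K] MatDual K N ⊗[K] MatDual K N :=
  ∑ i, ∑ j, (evalE K N i j).smulRight (∑ r, tau K N i r ⊗ₜ[K] tau K N r j)

/-- The bilinear form determined by the trace:
`τ_{i,j} ⊗ τ_{k,l} ↦ 1` if `i = l` and `j = k`, and `0` otherwise. -/
def traceForm : MatDual K N ⊗[K] MatDual K N →ₗ[K] K :=
  ∑ i, ∑ j, LinearMap.mul' K K ∘ₗ TensorProduct.map (evalE K N i j) (evalE K N j i)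

theorem matComul_tau (i j : Fin N) :
    matComul K N (tau K N i j) = ∑ r, tau K N i r ⊗ₜ[K] tau K N r j := by
  simp [matComul, evalE_tau, ite_and]

theorem traceForm_tau (i j k l : Fin N) :
    traceForm K N (tau K N i j ⊗ₜ tau K N k l) = if i = l ∧ j = k then 1 else 0 := by
  simp [traceForm, evalE_tau, ite_and]
  grind

end MatrixCoalgebra

end RepBracket

end

open RepBracket

noncomputable section

namespace RepBracket

/-! The algebra `A_M` is the non-unital algebra with the given generators and relations
(`exists_repAlg_lift`), and each homomorphism needed below is built from this universal property.
The grading is direct because the relations are homogeneous: `a_α ↦ a_α T^|a|` extends to a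
homomorphism into Laurent polynomials, and its coefficients recover the homogeneous components
(`exists_coaction`, `repGrading_isInternal`).

A graded derivation `D` of degree `d` is the same thing as a homomorphism into upper triangular 2 ×
2 matrices with diagonal entries `(-1)^(d|x|) x` and `x` and corner `D x`. Hence derivations of
`A_M` correspond to linear maps on the generators that respect the relation `(ab)_α = a_{α¹} b_{α²}`
(`exists_gradedDer`, `gradedDerEquiv`). For fixed `a_α`, the prescribed values of the bracket form
such a map: the Leibniz rule of the double bracket matches two identities for `v̂` that come from
coassociativity (`comul_vHat_right`, `comul_vHat_left`). Cyclicity of `v` together with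
commutativity of `A_M` turns antisymmetry of the double bracket into antisymmetry on generators
(`genBracket_antisymm`).

To allow an arbitrary first argument `u`, antisymmetry dictates the value of `{u, b_β}` from the
derivation `{b_β, -}`. Induction on `u` shows that these values again extend to a derivation, since
in a graded commutative algebra a left multiple of a derivation is a derivation
(`exists_induced_bracket`). Uniqueness holds because a biderivation is determined by its values on
generators.

For the Jacobi identity, the Jacobi form is, up to a sign, a commutator of derivations minus a
derivation, evaluated at the third argument. By cyclic symmetry it therefore suffices to check
generators (`jacobiator_eq_zero_of_gen`). There `{a_α, {b_β, c_γ}}` has two terms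
(`bracket_gen_bracket_gen`), and the six terms of the Jacobi form group into the tribrackets of `(a,
b, c)` and of `(a, c, b)`. The cyclic permutations in the tribracket are absorbed by the cyclic
symmetry of the iterated form (`vHat₃_cyclic`). The Poisson statement is the case with trivial
signs, and the matrix statement is a computation of `v̂` for the trace form. -/

theorem negOnePow_eq_ite (k : ℤ) : k.negOnePow = if Even k then 1 else -1 := by
  split_ifs with h
  · exact Int.negOnePow_even k h
  · exact Int.negOnePow_odd k (Int.not_even_iff_odd.mp h)

/-! ### Linear maps defined degree by degree -/

section GradedLift

variable {K A X : Type*} [CommRing K] [AddCommGroup A] [Module K A] [AddCommMonoid X] [Module K X]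
variable (𝒜 : ℤ → Submodule K A) [DirectSum.Decomposition 𝒜]

/-- The linear map on a graded module with given restrictions to the homogeneous parts. -/
def gradedLift (g : ∀ p, 𝒜 p →ₗ[K] X) : A →ₗ[K] X :=
  DirectSum.toModule K ℤ X g ∘ₗ (DirectSum.decomposeLinearEquiv 𝒜).toLinearMap

theorem gradedLift_of_mem (g : ∀ p, 𝒜 p →ₗ[K] X) {p : ℤ} {a : A} (ha : a ∈ 𝒜 p) :
    gradedLift 𝒜 g a = g p ⟨a, ha⟩ := by
  lift a to 𝒜 p using ha
  simp only [gradedLift, LinearMap.comp_apply, LinearEquiv.coe_coe,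
    DirectSum.decomposeLinearEquiv_apply, DirectSum.decompose_coe]
  erw [DirectSum.toModule_lof]

theorem graded_ext {f g : A →ₗ[K] X} (h : ∀ p, ∀ a ∈ 𝒜 p, f a = g a) : f = g := by
  ext a
  induction a using DirectSum.Decomposition.inductionOn 𝒜 with
  | zero => simp
  | add a b ha hb => simp [ha, hb]
  | @homogeneous p a => exact h p a a.2

theorem tensor_graded_ext {M : Type*} [AddCommGroup M] [Module K M] {f g : A ⊗[K] M →ₗ[K] X}
    (h : ∀ p, ∀ a ∈ 𝒜 p, ∀ α, f (a ⊗ₜ α) = g (a ⊗ₜ α)) : f = g := by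
  apply TensorProduct.ext
  refine graded_ext 𝒜 fun p a ha => ?_
  ext α
  exact h p a ha α

end GradedLift

/-! ### The representation algebra: universal property and grading -/

section RepAlg

variable {K A M : Type*} [CommRing K] [NonUnitalRing A] [Module K A]
  [AddCommGroup M] [Module K M]
variable (𝒜 : ℤ → Submodule K A) (μ : M →ₗ[K] M ⊗[K] M)

/-- The inclusion of the representation algebra into its unitization. -/
def toOne : RepAlg 𝒜 μ →ₙₐ[K] RepAlgOne 𝒜 μ :=
  NonUnitalSubalgebraClass.subtype (repSubalgebra 𝒜 μ)

theorem toOne_injective : Function.Injective (toOne 𝒜 μ) := Subtype.val_injective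

theorem toOne_gen (z : A ⊗[K] M) : toOne 𝒜 μ (gen 𝒜 μ z) = genOne 𝒜 μ z := rfl

/-- The product `a_φ b_ψ` summed over a tensor `φ ⊗ ψ`, for linear maps `f = a_(-)` and
`g = b_(-)`. -/
def prodMap {M' B : Type*} [AddCommGroup M'] [Module K M'] [NonUnitalRing B] [Module K B]
    [IsScalarTower K B B] [SMulCommClass K B B] (f : M →ₗ[K] B) (g : M' →ₗ[K] B) :
    M ⊗[K] M' →ₗ[K] B :=
  LinearMap.mul' K B ∘ₗ TensorProduct.map f g

@[simp]
theorem prodMap_tmul {M' B : Type*} [AddCommGroup M'] [Module K M'] [NonUnitalRing B] [Module K B]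
    [IsScalarTower K B B] [SMulCommClass K B B] (f : M →ₗ[K] B) (g : M' →ₗ[K] B) (x : M)
    (y : M') : prodMap f g (x ⊗ₜ y) = f x * g y := rfl

theorem prodMap_negOnePow_smul_left {M' B : Type*} [AddCommGroup M'] [Module K M']
    [NonUnitalRing B] [Module K B] [IsScalarTower K B B] [SMulCommClass K B B] (f : M →ₗ[K] B)
    (g : M' →ₗ[K] B) (k : ℤ) (z : M ⊗[K] M') :
    prodMap (k.negOnePow • f) g z = k.negOnePow • prodMap f g z := by
  induction z with
  | zero => simp
  | add x y hx hy => simp [hx, hy]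
  | tmul x y => simp [LinearMap.smul_apply, smul_mul_assoc]

theorem prodMap_negOnePow_smul_right {M' B : Type*} [AddCommGroup M'] [Module K M']
    [NonUnitalRing B] [Module K B] [IsScalarTower K B B] [SMulCommClass K B B] (f : M →ₗ[K] B)
    (g : M' →ₗ[K] B) (k : ℤ) (z : M ⊗[K] M') :
    prodMap f (k.negOnePow • g) z = k.negOnePow • prodMap f g z := by
  induction z with
  | zero => simp
  | add x y hx hy => simp [hx, hy]
  | tmul x y => simp [LinearMap.smul_apply, mul_smul_comm]

theorem map_prodMap {M' B C : Type*} [AddCommGroup M'] [Module K M'] [NonUnitalRing B] [Module K B]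
    [IsScalarTower K B B] [SMulCommClass K B B] [NonUnitalRing C] [Module K C]
    [IsScalarTower K C C] [SMulCommClass K C C] (f : M →ₗ[K] B) (g : M' →ₗ[K] B) (φ : B →ₙₐ[K] C)
    (z : M ⊗[K] M') :
    φ (prodMap f g z) = prodMap ((φ : B →ₗ[K] C) ∘ₗ f) ((φ : B →ₗ[K] C) ∘ₗ g) z := by
  induction z with
  | zero => simp
  | add x y hx hy => simp [hx, hy]
  | tmul x y => simp

theorem genOne_mul (a b : A) (α : M) :
    genOne 𝒜 μ ((a * b) ⊗ₜ α) = prodMap (genOne 𝒜 μ ∘ₗ TensorProduct.mk K A M a)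
      (genOne 𝒜 μ ∘ₗ TensorProduct.mk K A M b) (μ α) := by
  refine (RingQuot.mkAlgHom_rel K (RepRel.mul a b α)).trans ?_
  generalize μ α = z
  induction z with
  | zero => simp
  | add x y hx hy => simp [hx, hy]
  | tmul x y => simp [genOne]

theorem gen_mul (a b : A) (α : M) :
    gen 𝒜 μ ((a * b) ⊗ₜ α) = prodMap (gen 𝒜 μ ∘ₗ TensorProduct.mk K A M a)
      (gen 𝒜 μ ∘ₗ TensorProduct.mk K A M b) (μ α) := by
  apply toOne_injective
  rw [toOne_gen, genOne_mul, map_prodMap]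
  rfl

theorem gen_comm {p q : ℤ} {a b : A} (ha : a ∈ 𝒜 p) (hb : b ∈ 𝒜 q) (α β : M) :
    gen 𝒜 μ (a ⊗ₜ α) * gen 𝒜 μ (b ⊗ₜ β) =
      (p * q).negOnePow • (gen 𝒜 μ (b ⊗ₜ β) * gen 𝒜 μ (a ⊗ₜ α)) := by
  apply toOne_injective
  rw [negOnePow_eq_ite]
  have := RingQuot.mkAlgHom_rel K (RepRel.comm (μ := μ) p q a b ha hb α β)
  rw [negOnePow_eq_ite] at this
  split_ifs at this ⊢ with h <;> simpa [toOne_gen, genOne] using this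

@[elab_as_elim]
theorem repAlg_induction {P : RepAlg 𝒜 μ → Prop} (zero : P 0)
    (add : ∀ x y, P x → P y → P (x + y)) (smul : ∀ (k : K) x, P x → P (k • x))
    (mul : ∀ x y, P x → P y → P (x * y)) (gen : ∀ z, P (gen 𝒜 μ z)) (x : RepAlg 𝒜 μ) : P x := by
  obtain ⟨x, hx⟩ := x
  induction hx using NonUnitalAlgebra.adjoin_induction with
  | mem x hx =>
    obtain ⟨z, rfl⟩ := hx
    exact gen z
  | add x y hx hy h h' => exact add _ _ h h'
  | zero => exact zero
  | mul x y hx hy h h' => exact mul _ _ h h'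
  | smul r x hx h => exact smul r _ h

theorem repAlg_hom_ext {B : Type*} [NonUnitalRing B] [Module K B] {φ ψ : RepAlg 𝒜 μ →ₙₐ[K] B}
    (h : ∀ z, φ (gen 𝒜 μ z) = ψ (gen 𝒜 μ z)) : φ = ψ := by
  ext x
  induction x using repAlg_induction with
  | zero => simp
  | add x y hx hy => simp [hx, hy]
  | smul k x hx => simp [hx]
  | mul x y hx hy => simp [hx, hy]
  | gen z => exact h z

/-- The universal property of the representation algebra. -/
theorem exists_repAlg_lift [DirectSum.Decomposition 𝒜] [IsScalarTower K A A] [SMulCommClass K A A]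
    {B : Type*} [NonUnitalRing B] [Module K B]
    [IsScalarTower K B B] [SMulCommClass K B B] (f : A ⊗[K] M →ₗ[K] B)
    (hmul : ∀ p q, ∀ a ∈ 𝒜 p, ∀ b ∈ 𝒜 q, ∀ α, f ((a * b) ⊗ₜ α) =
      prodMap (f ∘ₗ TensorProduct.mk K A M a) (f ∘ₗ TensorProduct.mk K A M b) (μ α))
    (hcomm : ∀ p q, ∀ a ∈ 𝒜 p, ∀ b ∈ 𝒜 q, ∀ α β,
      f (a ⊗ₜ α) * f (b ⊗ₜ β) = (p * q).negOnePow • (f (b ⊗ₜ β) * f (a ⊗ₜ α))) :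
    ∃ φ : RepAlg 𝒜 μ →ₙₐ[K] B, ∀ z, φ (gen 𝒜 μ z) = f z := by
  have hmul' : ∀ a b α, f ((a * b) ⊗ₜ α) =
      prodMap (f ∘ₗ TensorProduct.mk K A M a) (f ∘ₗ TensorProduct.mk K A M b) (μ α) := by
    intro a b α
    induction a using DirectSum.Decomposition.inductionOn 𝒜 with
    | zero => simp [prodMap, LinearMap.comp_zero]
    | add a a' h h' =>
      simp only [prodMap, map_add, add_mul, TensorProduct.add_tmul, LinearMap.comp_add,
        TensorProduct.map_add_left, LinearMap.comp_apply, LinearMap.add_apply] at h h' ⊢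
      rw [h, h']
    | @homogeneous p a =>
      induction b using DirectSum.Decomposition.inductionOn 𝒜 with
      | zero => simp [prodMap, LinearMap.comp_zero]
      | add a a' h h' =>
        simp only [prodMap, map_add, mul_add, TensorProduct.add_tmul, LinearMap.comp_add,
          TensorProduct.map_add_right, LinearMap.comp_apply, LinearMap.add_apply] at h h' ⊢
        rw [h, h']
      | @homogeneous q b => exact hmul p q a a.2 b b.2 α
  let F : TensorAlgebra K (A ⊗[K] M) →ₐ[K] Unitization K B :=
    TensorAlgebra.lift K ((Unitization.inrNonUnitalAlgHom K B : B →ₗ[K] Unitization K B) ∘ₗ f)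
  have hF : ∀ z, F (TensorAlgebra.ι K z) = ((f z : B) : Unitization K B) := fun z => by simp [F]
  let Φ : RepAlgOne 𝒜 μ →ₐ[K] Unitization K B := RingQuot.liftAlgHom K ⟨F, by
    intro x y h
    induction h with
    | mul a b α =>
      rw [hF, hmul']
      generalize μ α = z
      induction z with
      | zero => simp
      | add x y hx hy => simp only [map_add, Unitization.inr_add, hx, hy]
      | tmul x y => simp [hF]
    | comm p q a b ha hb α β =>
      have := hcomm p q a ha b hb α β
      rw [negOnePow_eq_ite] at this ⊢
      split_ifs at this ⊢ with h <;>
        simp [hF, ← Unitization.inr_mul, this]⟩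
  have hΦ : ∀ z, Φ (genOne 𝒜 μ z) = ((f z : B) : Unitization K B) := fun z => by
    simp only [Φ, genOne, LinearMap.comp_apply, AlgHom.toLinearMap_apply,
      RingQuot.liftAlgHom_mkAlgHom_apply, hF]
  -- The scalar part vanishes on the non-unital subalgebra, which is why the second component of `Φ`
  -- is multiplicative there and gives a homomorphism into `B` itself.
  have hfst : ∀ x : RepAlg 𝒜 μ, (Φ (toOne 𝒜 μ x)).fst = 0 := by
    intro x
    induction x using repAlg_induction with
    | zero => simp
    | add x y hx hy => simp [hx, hy]
    | smul k x hx => simp [hx]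
    | mul x y hx hy => simp [hx, hy]
    | gen z => simp [toOne_gen, hΦ]
  refine ⟨{ toFun := fun x => (Φ (toOne 𝒜 μ x)).snd
            map_smul' := by simp
            map_zero' := by simp
            map_add' := by simp
            map_mul' := by simp [hfst] }, fun z => ?_⟩
  change (Φ (toOne 𝒜 μ (gen 𝒜 μ z))).snd = f z
  rw [toOne_gen, hΦ]
  simp

/-! ### The grading -/

theorem gen_mem {p : ℤ} {a : A} (ha : a ∈ 𝒜 p) (α : M) :
    gen 𝒜 μ (a ⊗ₜ α) ∈ repGrading 𝒜 μ p :=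
  Submodule.subset_span (IsMonomial.gen p a ha α)

theorem repGrading_mul {p q : ℤ} {x y : RepAlg 𝒜 μ} (hx : x ∈ repGrading 𝒜 μ p)
    (hy : y ∈ repGrading 𝒜 μ q) : x * y ∈ repGrading 𝒜 μ (p + q) := by
  induction hx using Submodule.span_induction with
  | zero => simp
  | add x x' _ _ h h' => rw [add_mul]; exact add_mem h h'
  | smul k x _ h => rw [smul_mul_assoc]; exact Submodule.smul_mem _ _ h
  | mem x hx =>
    induction hy using Submodule.span_induction with
    | zero => simp
    | add x x' _ _ h h' => rw [mul_add]; exact add_mem h h'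
    | smul k x _ h => rw [mul_smul_comm]; exact Submodule.smul_mem _ _ h
    | mem y hy => exact Submodule.subset_span (IsMonomial.mul p q x y hx hy)

instance : SetLike.GradedMul (repGrading 𝒜 μ) where
  mul_mem _ _ _ _ hx hy := repGrading_mul 𝒜 μ hx hy

theorem negOnePow_smul_mem {X : Type*} [AddCommGroup X] [Module K X] {S : Submodule K X} (k : ℤ)
    {x : X} (hx : x ∈ S) : k.negOnePow • x ∈ S := by
  rw [negOnePow_eq_ite]
  split_ifs
  · simpa using hx
  · simpa using hx

@[elab_as_elim]
theorem homogeneous_induction {P : ∀ (p : ℤ) (x : RepAlg 𝒜 μ), x ∈ repGrading 𝒜 μ p → Prop}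
    (zero : ∀ p, P p 0 (zero_mem _))
    (add : ∀ p x y hx hy, P p x hx → P p y hy → P p (x + y) (add_mem hx hy))
    (smul : ∀ (k : K) p x hx, P p x hx → P p (k • x) (Submodule.smul_mem _ k hx))
    (mul : ∀ p q x y hx hy, P p x hx → P q y hy → P (p + q) (x * y) (repGrading_mul 𝒜 μ hx hy))
    (gen : ∀ p a (ha : a ∈ 𝒜 p) α, P p (gen 𝒜 μ (a ⊗ₜ α)) (gen_mem 𝒜 μ ha α))
    {p : ℤ} {x : RepAlg 𝒜 μ} (hx : x ∈ repGrading 𝒜 μ p) : P p x hx := by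
  induction hx using Submodule.span_induction with
  | zero => exact zero p
  | add x y hx hy h h' => exact add p x y hx hy h h'
  | smul k x hx h => exact smul k p x hx h
  | mem x h =>
    induction h with
    | gen p a ha α => exact gen p a ha α
    | mul p q x y hx hy h h' =>
      exact mul p q x y (Submodule.subset_span hx) (Submodule.subset_span hy) h h'

/-- The sign `(-1)^(pq)` is multiplicative in each degree, so the commutation rule passes from
generators to products. -/
theorem repGrading_comm {p q : ℤ} {x y : RepAlg 𝒜 μ} (hx : x ∈ repGrading 𝒜 μ p)
    (hy : y ∈ repGrading 𝒜 μ q) : x * y = (p * q).negOnePow • (y * x) := by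
  induction hx using homogeneous_induction generalizing q y with
  | zero => simp
  | add p x x' _ _ h h' => rw [add_mul, mul_add, h hy, h' hy, smul_add]
  | smul k p x _ h => rw [smul_mul_assoc, mul_smul_comm, h hy, smul_comm]
  | mul p p' x x' _ _ h h' =>
    rw [mul_assoc, h' hy, mul_smul_comm, ← mul_assoc, h hy, smul_mul_assoc, smul_smul,
      ← Int.negOnePow_add, mul_assoc, add_mul, add_comm]
  | gen p a ha α =>
    induction hy using homogeneous_induction with
    | zero => simp
    | add p x x' _ _ h h' => rw [add_mul, mul_add, h, h', smul_add]
    | smul k p x _ h => rw [smul_mul_assoc, mul_smul_comm, h, smul_comm]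
    | mul q q' y y' _ _ h h' =>
      rw [← mul_assoc, h, smul_mul_assoc, mul_assoc, h', mul_smul_comm, smul_smul,
        ← Int.negOnePow_add, mul_assoc, mul_add]
    | gen q b hb β => exact gen_comm 𝒜 μ ha hb α β

variable [DirectSum.Decomposition 𝒜]

theorem iSup_repGrading : ⨆ p, repGrading 𝒜 μ p = ⊤ := by
  rw [eq_top_iff]
  rintro x -
  induction x using repAlg_induction with
  | zero => exact zero_mem _
  | add x y hx hy => exact add_mem hx hy
  | smul k x hx => exact Submodule.smul_mem _ _ hx
  | mul x y hx hy =>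
    induction hx using Submodule.iSup_induction' with
    | zero => simp
    | add x x' _ _ h h' => rw [add_mul]; exact add_mem h h'
    | mem p x hx =>
      induction hy using Submodule.iSup_induction' with
      | zero => simp
      | add x x' _ _ h h' => rw [mul_add]; exact add_mem h h'
      | mem q y hy => exact Submodule.mem_iSup_of_mem (p + q) (repGrading_mul 𝒜 μ hx hy)
  | gen z =>
    induction z with
    | zero => simp
    | add x y hx hy => rw [map_add]; exact add_mem hx hy
    | tmul a α =>
      induction a using DirectSum.Decomposition.inductionOn 𝒜 with
      | zero => simp
      | add x y hx hy => rw [TensorProduct.add_tmul, map_add]; exact add_mem hx hy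
      | @homogeneous p a => exact Submodule.mem_iSup_of_mem p (gen_mem 𝒜 μ a.2 α)

/-- The coaction `a_α ↦ a_α T ^ |a|` which determines the grading. -/
theorem exists_coaction [IsScalarTower K A A] [SMulCommClass K A A] [SetLike.GradedMul 𝒜]
    {U : Type*} [Ring U] [Algebra K U] (ι : RepAlg 𝒜 μ →ₙₐ[K] U) :
    ∃ φ : RepAlg 𝒜 μ →ₙₐ[K] AddMonoidAlgebra U ℤ,
      ∀ p, ∀ x ∈ repGrading 𝒜 μ p, φ x = AddMonoidAlgebra.single p (ι x) := by
  let g : A →ₗ[K] M →ₗ[K] AddMonoidAlgebra U ℤ := gradedLift 𝒜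
    (X := M →ₗ[K] AddMonoidAlgebra U ℤ) fun p =>
      LinearMap.compr₂ (TensorProduct.mk K A M)
        (AddMonoidAlgebra.lsingle (R := K) p ∘ₗ (ι : RepAlg 𝒜 μ →ₗ[K] U) ∘ₗ gen 𝒜 μ) ∘ₗ
          (𝒜 p).subtype
  have hg : ∀ p, ∀ a ∈ 𝒜 p, ∀ α, TensorProduct.lift g (a ⊗ₜ α) =
      AddMonoidAlgebra.single p (ι (gen 𝒜 μ (a ⊗ₜ α))) := by
    intro p a ha α
    rw [TensorProduct.lift.tmul, gradedLift_of_mem 𝒜 _ ha]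
    rfl
  obtain ⟨φ, hφ⟩ := exists_repAlg_lift 𝒜 μ (TensorProduct.lift g) (by
    intro p q a ha b hb α
    rw [hg _ _ (SetLike.GradedMul.mul_mem ha hb), gen_mul, map_prodMap]
    generalize μ α = z
    induction z with
    | zero => simp
    | add x y hx hy => simp only [map_add, AddMonoidAlgebra.single_add, hx, hy]
    | tmul x y =>
      simp only [prodMap_tmul, LinearMap.comp_apply, TensorProduct.mk_apply, hg _ _ ha, hg _ _ hb,
        AddMonoidAlgebra.single_mul_single]
      rfl) (by
    intro p q a ha b hb α β
    have := congrArg ι (gen_comm 𝒜 μ ha hb α β)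
    rw [hg _ _ ha, hg _ _ hb, AddMonoidAlgebra.single_mul_single,
      AddMonoidAlgebra.single_mul_single, add_comm q p]
    rw [negOnePow_eq_ite] at this ⊢
    split_ifs at this ⊢ <;> simp_all)
  refine ⟨φ, fun p x hx => ?_⟩
  induction hx using homogeneous_induction with
  | zero => simp
  | add p x y _ _ h h' => simp [h, h']
  | smul k p x _ h => rw [map_smul, map_smul, h, AddMonoidAlgebra.smul_single]
  | mul p q x y _ _ h h' => rw [map_mul, map_mul, h, h', AddMonoidAlgebra.single_mul_single]
  | gen p a ha α => rw [hφ, hg p a ha]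

/-- The coaction separates degrees: the coefficient of `T^p` in the image of a sum of homogeneous
elements is the component of degree `p`. Laurent polynomials need unital coefficients, whence the
unitization, into which `A_M` embeds. -/
theorem repGrading_isInternal [IsScalarTower K A A] [SMulCommClass K A A]
    [SetLike.GradedMul 𝒜] : DirectSum.IsInternal (repGrading 𝒜 μ) := by
  obtain ⟨φ, hφ⟩ :=
    exists_coaction 𝒜 μ (Unitization.inrNonUnitalAlgHom K (RepAlg 𝒜 μ))
  refine ⟨(injective_iff_map_eq_zero _).mpr fun x hx => ?_, ?_⟩
  · have key : ∀ y : DirectSum ℤ fun p => repGrading 𝒜 μ p, ∀ p,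
        (φ (DirectSum.coeAddMonoidHom _ y)).coeff p =
          ((y p : RepAlg 𝒜 μ) : Unitization K (RepAlg 𝒜 μ)) := by
      intro y p
      induction y using DirectSum.induction_on with
      | zero => simp
      | add y z hy hz => simp [hy, hz]
      | of q y =>
        rw [DirectSum.coeAddMonoidHom_of, hφ q y y.2]
        by_cases h : q = p
        · subst h; simp [AddMonoidAlgebra.coeff_single, -LaurentPolynomial.single_eq_C_mul_T]
        · rw [DirectSum.of_eq_of_ne _ _ _ (Ne.symm h)]
          simp [AddMonoidAlgebra.coeff_single, h, -LaurentPolynomial.single_eq_C_mul_T]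
    refine DFinsupp.ext fun p => ?_
    have := key x p
    rw [hx] at this
    simp only [map_zero, AddMonoidAlgebra.coeff_zero, Finsupp.coe_zero, Pi.zero_apply] at this
    exact Subtype.ext (Unitization.inr_injective (by rw [← this]; simp))
  · have := iSup_repGrading 𝒜 μ
    rw [Submodule.iSup_eq_range_dfinsupp_lsum, LinearMap.range_eq_top] at this
    exact this

end RepAlg

/-! ### Graded derivations and their restriction to the generators -/

section Derivations

variable {K A M : Type*} [CommRing K] [NonUnitalRing A] [Module K A]
  [AddCommGroup M] [Module K M]
variable (𝒜 : ℤ → Submodule K A) (μ : M →ₗ[K] M ⊗[K] M)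

/-- The graded derivations of degree `d` of the representation algebra. -/
def gradedDer (d : ℤ) : Submodule K (RepAlg 𝒜 μ →ₗ[K] RepAlg 𝒜 μ) where
  carrier := {D | (∀ p, ∀ x ∈ repGrading 𝒜 μ p, D x ∈ repGrading 𝒜 μ (p + d)) ∧
    ∀ p q, ∀ x ∈ repGrading 𝒜 μ p, ∀ y ∈ repGrading 𝒜 μ q,
      D (x * y) = D x * y + (d * p).negOnePow • (x * D y)}
  add_mem' {D E} hD hE := ⟨fun p x hx => add_mem (hD.1 p x hx) (hE.1 p x hx),
    fun p q x hx y hy => by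
      simp only [LinearMap.add_apply, hD.2 p q x hx y hy, hE.2 p q x hx y hy, add_mul, mul_add,
        smul_add]
      abel⟩
  zero_mem' := ⟨fun p x _ => by simp, fun p q x _ y _ => by simp⟩
  smul_mem' k D hD := ⟨fun p x hx => Submodule.smul_mem _ k (hD.1 p x hx), fun p q x hx y hy => by
    simp only [LinearMap.smul_apply, hD.2 p q x hx y hy, smul_mul_assoc, mul_smul_comm, smul_add]
    rw [smul_comm]⟩

/-- The linear maps `A ⊗ M → A_M` which satisfy the conditions on the restriction of a graded
derivation of degree `d` to the generators. -/
def genDer (d : ℤ) : Submodule K (A ⊗[K] M →ₗ[K] RepAlg 𝒜 μ) where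
  carrier := {f | (∀ p, ∀ a ∈ 𝒜 p, ∀ α, f (a ⊗ₜ α) ∈ repGrading 𝒜 μ (p + d)) ∧
    ∀ p q, ∀ a ∈ 𝒜 p, ∀ b ∈ 𝒜 q, ∀ α, f ((a * b) ⊗ₜ α) =
      prodMap (f ∘ₗ TensorProduct.mk K A M a) (gen 𝒜 μ ∘ₗ TensorProduct.mk K A M b) (μ α) +
      (d * p).negOnePow •
        prodMap (gen 𝒜 μ ∘ₗ TensorProduct.mk K A M a) (f ∘ₗ TensorProduct.mk K A M b) (μ α)}
  add_mem' {D E} hD hE := ⟨fun p x hx α => add_mem (hD.1 p x hx α) (hE.1 p x hx α),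
    fun p q x hx y hy α => by
      simp only [LinearMap.add_apply, hD.2 p q x hx y hy, hE.2 p q x hx y hy, prodMap,
        LinearMap.add_comp, TensorProduct.map_add_left, TensorProduct.map_add_right,
        LinearMap.comp_add, smul_add]
      abel⟩
  zero_mem' := ⟨fun p x _ α => by simp, fun p q x _ y _ α => by simp [prodMap]⟩
  smul_mem' k D hD := ⟨fun p x hx α => Submodule.smul_mem _ k (hD.1 p x hx α),
    fun p q x hx y hy α => by
      simp only [LinearMap.smul_apply, hD.2 p q x hx y hy, prodMap, LinearMap.smul_comp,
        TensorProduct.map_smul_left, TensorProduct.map_smul_right, LinearMap.comp_smul, smul_add]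
      rw [smul_comm]⟩

variable {𝒜 μ}

theorem gradedDer_mul {d p q : ℤ} {D : RepAlg 𝒜 μ →ₗ[K] RepAlg 𝒜 μ} (hD : D ∈ gradedDer 𝒜 μ d)
    {x y : RepAlg 𝒜 μ} (hx : x ∈ repGrading 𝒜 μ p) (hy : y ∈ repGrading 𝒜 μ q) :
    D (x * y) = D x * y + (d * p).negOnePow • (x * D y) := hD.2 p q x hx y hy

theorem linearMap_negOnePow_smul {X Y : Type*} [AddCommGroup X] [Module K X] [AddCommGroup Y]
    [Module K Y] (f : X →ₗ[K] Y) (k : ℤ) (x : X) : f (k.negOnePow • x) = k.negOnePow • f x := by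
  rw [negOnePow_eq_ite]
  split_ifs <;> simp

theorem restrict_mem_genDer [SetLike.GradedMul 𝒜] {d : ℤ} {D : RepAlg 𝒜 μ →ₗ[K] RepAlg 𝒜 μ}
    (hD : D ∈ gradedDer 𝒜 μ d) : D ∘ₗ gen 𝒜 μ ∈ genDer 𝒜 μ d := by
  refine ⟨fun p a ha α => hD.1 p _ (gen_mem 𝒜 μ ha α), fun p q a ha b hb α => ?_⟩
  rw [LinearMap.comp_apply, gen_mul]
  generalize μ α = z
  induction z with
  | zero => simp
  | add x y hx hy => simp only [map_add, hx, hy, smul_add]; abel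
  | tmul x y => exact gradedDer_mul hD (gen_mem 𝒜 μ ha x) (gen_mem 𝒜 μ hb y)

theorem repAlg_linear_ext [DirectSum.Decomposition 𝒜] {X : Type*} [AddCommGroup X] [Module K X]
    {D E : RepAlg 𝒜 μ →ₗ[K] X}
    (h : ∀ p, ∀ x ∈ repGrading 𝒜 μ p, D x = E x) : D = E := by
  ext x
  have hx : x ∈ ⨆ p, repGrading 𝒜 μ p := by rw [iSup_repGrading]; trivial
  induction hx using Submodule.iSup_induction' with
  | zero => simp
  | add x x' _ _ h h' => rw [map_add, map_add, h, h']
  | mem p x hx => exact h p x hx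

theorem gradedDer_ext [DirectSum.Decomposition 𝒜] {d : ℤ} {D E : RepAlg 𝒜 μ →ₗ[K] RepAlg 𝒜 μ}
    (hD : D ∈ gradedDer 𝒜 μ d) (hE : E ∈ gradedDer 𝒜 μ d)
    (h : ∀ p, ∀ a ∈ 𝒜 p, ∀ α, D (gen 𝒜 μ (a ⊗ₜ α)) = E (gen 𝒜 μ (a ⊗ₜ α))) : D = E := by
  refine repAlg_linear_ext fun p x hx => ?_
  induction hx using homogeneous_induction with
  | zero => simp
  | add p x y _ _ h h' => simp [h, h']
  | smul k p x _ h => simp [h]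
  | mul p q x y hx hy h h' => rw [gradedDer_mul hD hx hy, gradedDer_mul hE hx hy, h, h']
  | gen p a ha α => exact h p a ha α

theorem gen_signOp [DirectSum.Decomposition 𝒜] {d p : ℤ} {a : A} (ha : a ∈ 𝒜 p) (α : M) :
    gen 𝒜 μ (TensorProduct.map (signOp 𝒜 0 d) LinearMap.id (a ⊗ₜ α)) =
      (d * p).negOnePow • gen 𝒜 μ (a ⊗ₜ α) := by
  simp only [TensorProduct.map_tmul, signOp_of_mem 𝒜 ha, LinearMap.id_apply, add_zero]
  rw [negOnePow_eq_ite]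
  split_ifs <;> simp [TensorProduct.neg_tmul]

theorem triangular_mul {R : Type*} [NonUnitalRing R] (a b c a' b' c' : R) :
    !![a, b; 0, c] * !![a', b'; 0, c'] = !![a * a', a * b' + b * c'; 0, c * c'] := by
  ext i j
  fin_cases i <;> fin_cases j <;> simp [Matrix.mul_apply, Fin.sum_univ_two]

theorem negOnePow_smul_triangular {R : Type*} [NonUnitalRing R] (k : ℤ) (a b c : R) :
    k.negOnePow • !![a, b; 0, c] = !![k.negOnePow • a, k.negOnePow • b; 0, k.negOnePow • c] := by
  ext i j
  fin_cases i <;> fin_cases j <;> simp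

/-- A derivation is encoded as a homomorphism into triangular matrices. The Leibniz condition on `f`
is multiplicativity of the corner entry, and the sign on the upper left entry supplies the sign in
the Leibniz rule. -/
theorem exists_triangular_hom [DirectSum.Decomposition 𝒜] [IsScalarTower K A A]
    [SMulCommClass K A A]
    [SetLike.GradedMul 𝒜] {d : ℤ}
    {f : A ⊗[K] M →ₗ[K] RepAlg 𝒜 μ} (hf : f ∈ genDer 𝒜 μ d) :
    ∃ φ : RepAlg 𝒜 μ →ₙₐ[K] Matrix (Fin 2) (Fin 2) (RepAlg 𝒜 μ), ∀ z, φ (gen 𝒜 μ z) =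
      !![gen 𝒜 μ (TensorProduct.map (signOp 𝒜 0 d) LinearMap.id z), f z; 0, gen 𝒜 μ z] := by
  let g : A ⊗[K] M →ₗ[K] RepAlg 𝒜 μ :=
    gen 𝒜 μ ∘ₗ TensorProduct.map (signOp 𝒜 0 d) LinearMap.id
  have hg : ∀ p, ∀ a ∈ 𝒜 p, ∀ α, g (a ⊗ₜ α) = (d * p).negOnePow • gen 𝒜 μ (a ⊗ₜ α) :=
    fun p a ha α => gen_signOp ha α
  let F : A ⊗[K] M →ₗ[K] Matrix (Fin 2) (Fin 2) (RepAlg 𝒜 μ) :=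
    { toFun z := !![g z, f z; 0, gen 𝒜 μ z]
      map_add' x y := by ext i j; fin_cases i <;> fin_cases j <;> simp
      map_smul' k x := by ext i j; fin_cases i <;> fin_cases j <;> simp }
  have hF : ∀ z, F z = !![g z, f z; 0, gen 𝒜 μ z] := fun z => rfl
  have hprod : ∀ a b z, prodMap (F ∘ₗ TensorProduct.mk K A M a) (F ∘ₗ TensorProduct.mk K A M b) z =
      !![prodMap (g ∘ₗ TensorProduct.mk K A M a) (g ∘ₗ TensorProduct.mk K A M b) z,
        prodMap (g ∘ₗ TensorProduct.mk K A M a) (f ∘ₗ TensorProduct.mk K A M b) z +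
        prodMap (f ∘ₗ TensorProduct.mk K A M a) (gen 𝒜 μ ∘ₗ TensorProduct.mk K A M b) z; 0,
        prodMap (gen 𝒜 μ ∘ₗ TensorProduct.mk K A M a) (gen 𝒜 μ ∘ₗ TensorProduct.mk K A M b) z] := by
    intro a b z
    induction z with
    | zero => ext i j; fin_cases i <;> fin_cases j <;> simp
    | add x y hx hy =>
      rw [map_add, hx, hy]
      ext i j; fin_cases i <;> fin_cases j <;> simp
      abel
    | tmul x y => exact triangular_mul (R := RepAlg 𝒜 μ) _ _ _ _ _ _
  have hgp : ∀ p, ∀ a ∈ 𝒜 p, g ∘ₗ TensorProduct.mk K A M a =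
      (d * p).negOnePow • (gen 𝒜 μ ∘ₗ TensorProduct.mk K A M a) := by
    intro p a ha
    ext α
    exact hg p a ha α
  refine exists_repAlg_lift 𝒜 μ F (fun p q a ha b hb α => ?_) fun p q a ha b hb α β => ?_
  · rw [hprod, hF, hf.2 p q a ha b hb, hg _ _ (SetLike.GradedMul.mul_mem ha hb), gen_mul,
      hgp p a ha, hgp q b hb, mul_add, Int.negOnePow_add]
    simp only [prodMap_negOnePow_smul_left, prodMap_negOnePow_smul_right, smul_smul]
    rw [add_comm, mul_comm]
  · rw [hF, hF, hg _ _ ha, hg _ _ hb, triangular_mul, triangular_mul, negOnePow_smul_triangular]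
    have h1 := gen_comm 𝒜 μ ha hb α β
    have h2 := repGrading_comm 𝒜 μ (hf.1 p a ha α) (gen_mem 𝒜 μ hb β)
    have h3 := repGrading_comm 𝒜 μ (gen_mem 𝒜 μ ha α) (hf.1 q b hb β)
    have e1 : (d * p).negOnePow • gen 𝒜 μ (a ⊗ₜ α) * (d * q).negOnePow • gen 𝒜 μ (b ⊗ₜ β) =
        (p * q).negOnePow •
          ((d * q).negOnePow • gen 𝒜 μ (b ⊗ₜ β) * (d * p).negOnePow • gen 𝒜 μ (a ⊗ₜ α)) := by
      rw [smul_mul_smul_comm, h1, smul_mul_smul_comm, smul_smul, smul_smul]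
      congr 1
      rw [mul_comm, mul_comm (d * p).negOnePow]
    -- Commutation of the corner entries: `f` raises degrees by `d`, so exchanging factors yields
    -- `(-1)^(p(q+d))` or `(-1)^((p+d)q)`. The surplus signs are those on the upper left entries.
    have e2 : (d * p).negOnePow • gen 𝒜 μ (a ⊗ₜ α) * f (b ⊗ₜ β) +
        f (a ⊗ₜ α) * gen 𝒜 μ (b ⊗ₜ β) = (p * q).negOnePow •
          ((d * q).negOnePow • gen 𝒜 μ (b ⊗ₜ β) * f (a ⊗ₜ α) +
            f (b ⊗ₜ β) * gen 𝒜 μ (a ⊗ₜ α)) := by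
      rw [smul_mul_assoc, smul_mul_assoc, h2, h3, smul_add, smul_smul, smul_smul,
        ← Int.negOnePow_add, ← Int.negOnePow_add, add_comm, add_mul, mul_add, mul_comm p d,
        ← add_assoc, add_comm (d * p) (p * q), add_assoc, Int.negOnePow_add (p * q) (d * p + d * p),
        Int.negOnePow_even (d * p + d * p) ⟨_, rfl⟩, mul_one]
    rw [e1, e2, h1]

/-- The derivation is the corner entry of the triangular homomorphism. The shape of the other three
entries, known on generators, persists on all of `A_M`. -/
theorem exists_gradedDer [DirectSum.Decomposition 𝒜] [IsScalarTower K A A] [SMulCommClass K A A]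
    [SetLike.GradedMul 𝒜] {d : ℤ}
    {f : A ⊗[K] M →ₗ[K] RepAlg 𝒜 μ} (hf : f ∈ genDer 𝒜 μ d) :
    ∃ D ∈ gradedDer 𝒜 μ d, D ∘ₗ gen 𝒜 μ = f := by
  obtain ⟨φ, hφ⟩ := exists_triangular_hom hf
  have hg : ∀ p, ∀ a ∈ 𝒜 p, ∀ α, gen 𝒜 μ (TensorProduct.map (signOp 𝒜 0 d) LinearMap.id (a ⊗ₜ α)) =
      (d * p).negOnePow • gen 𝒜 μ (a ⊗ₜ α) := fun p a ha α => gen_signOp ha α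
  have h10 : ∀ x, φ x 1 0 = 0 := by
    intro x
    induction x using repAlg_induction with
    | zero => simp
    | add x y hx hy => simp [hx, hy]
    | smul k x hx => simp [hx]
    | mul x y hx hy => simp [hx, hy, Matrix.mul_apply, Fin.sum_univ_two]
    | gen z => simp [hφ]
  have h11 : ∀ x, φ x 1 1 = x := by
    intro x
    induction x using repAlg_induction with
    | zero => simp
    | add x y hx hy => simp [hx, hy]
    | smul k x hx => simp [hx]
    | mul x y hx hy => simp [hx, hy, h10, Matrix.mul_apply, Fin.sum_univ_two]
    | gen z => simp [hφ]
  have h00 : ∀ p, ∀ x ∈ repGrading 𝒜 μ p, φ x 0 0 = (d * p).negOnePow • x := by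
    intro p x hx
    induction hx using homogeneous_induction with
    | zero => simp
    | add p x y _ _ h h' => simp [h, h']
    | smul k p x _ h => simp [h, smul_comm k]
    | mul p q x y hx hy h h' =>
      simp [h, h', h10, Matrix.mul_apply, Fin.sum_univ_two, mul_add, Int.negOnePow_add,
        smul_mul_smul_comm]
    | gen p a ha α => rw [hφ]; exact hg p a ha α
  -- The corner of a product of triangular matrices is exactly the graded Leibniz rule.
  have h01 : ∀ p, ∀ x ∈ repGrading 𝒜 μ p, ∀ y,
      φ (x * y) 0 1 = φ x 0 1 * y + (d * p).negOnePow • (x * φ y 0 1) := by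
    intro p x hx y
    simp [Matrix.mul_apply, Fin.sum_univ_two, h11, h00 p x hx, add_comm, smul_mul_assoc]
  refine ⟨Matrix.entryLinearMap K (RepAlg 𝒜 μ) 0 1 ∘ₗ
    (φ : RepAlg 𝒜 μ →ₗ[K] Matrix (Fin 2) (Fin 2) (RepAlg 𝒜 μ)), ⟨fun p x hx => ?_,
    fun p q x hx y hy => h01 p x hx y⟩, ?_⟩
  · change φ x 0 1 ∈ _
    induction hx using homogeneous_induction with
    | zero => simp
    | add p x y _ _ h h' => simpa using add_mem h h'
    | smul k p x _ h => simpa using Submodule.smul_mem _ k h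
    | mul p q x y hx hy h h' =>
      rw [h01 p x hx]
      refine add_mem ?_ (negOnePow_smul_mem _ ?_)
      · have := repGrading_mul 𝒜 μ h hy
        rwa [add_right_comm] at this
      · have := repGrading_mul 𝒜 μ hx h'
        rwa [← add_assoc] at this
    | gen p a ha α => simpa [hφ] using hf.1 p a ha α
  · ext a α
    change φ (gen 𝒜 μ (a ⊗ₜ α)) 0 1 = _
    simp [hφ]

variable (𝒜 μ) [DirectSum.Decomposition 𝒜] [IsScalarTower K A A] [SMulCommClass K A A]
    [SetLike.GradedMul 𝒜]

/-- Graded derivations of the representation algebra are determined by their restrictions to the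
generators. -/
def gradedDerEquiv (d : ℤ) : gradedDer 𝒜 μ d ≃ₗ[K] genDer 𝒜 μ d :=
  LinearEquiv.ofBijective
    ((LinearMap.lcomp K (RepAlg 𝒜 μ) (gen 𝒜 μ)).restrict fun _ => restrict_mem_genDer) <| by
    refine ⟨fun D E h => Subtype.ext (gradedDer_ext D.2 E.2 fun p a _ α => ?_), fun f => ?_⟩
    · exact LinearMap.congr_fun (congrArg Subtype.val h) (a ⊗ₜ α)
    · obtain ⟨D, hD, h⟩ := exists_gradedDer f.2
      exact ⟨⟨D, hD⟩, Subtype.ext h⟩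

theorem gradedDerEquiv_symm_gen {d : ℤ} (f : genDer 𝒜 μ d) (z : A ⊗[K] M) :
    ((gradedDerEquiv 𝒜 μ d).symm f : RepAlg 𝒜 μ →ₗ[K] RepAlg 𝒜 μ) (gen 𝒜 μ z) =
      (f : A ⊗[K] M →ₗ[K] RepAlg 𝒜 μ) z := by
  obtain ⟨D, rfl⟩ := (gradedDerEquiv 𝒜 μ d).surjective f
  rw [LinearEquiv.symm_apply_apply]
  rfl

end Derivations

/-! ### Identities for `v̂` from coassociativity and cyclicity -/

section CyclicForms

variable {K M : Type*} [CommRing K] [AddCommGroup M] [Module K M]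

/-- The linear map `β ⊗ γ ↦ v (α ⊗ β) γ`. -/
def contract (v : M ⊗[K] M →ₗ[K] K) (α : M) : M ⊗[K] M →ₗ[K] M :=
  ((TensorProduct.lid K M).toLinearMap ∘ₗ TensorProduct.map v LinearMap.id ∘ₗ
    (TensorProduct.assoc K M M M).symm.toLinearMap) ∘ₗ TensorProduct.mk K M (M ⊗[K] M) α

theorem contract_tmul (v : M ⊗[K] M →ₗ[K] K) (α β γ : M) :
    contract v α (β ⊗ₜ γ) = v (α ⊗ₜ β) • γ := by
  simp [contract]

variable {μ : M →ₗ[K] M ⊗[K] M} {v : M ⊗[K] M →ₗ[K] K}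

theorem vHat_tmul (α β : M) :
    vHat μ v (α ⊗ₜ β) = TensorProduct.map LinearMap.id (contract v α ∘ₗ μ) (μ β) := by
  simp only [vHat, LinearMap.comp_apply, TensorProduct.map_tmul, LinearMap.id_apply]
  generalize μ β = z
  induction z with
  | zero => simp
  | add x y hx hy => simp only [map_add, TensorProduct.tmul_add, hx, hy]
  | tmul x y => simp [contract]

/-- By coassociativity both sides are `v(α ⊗ β¹) β² ⊗ β³`. -/
theorem comul_contract (hμ : IsCoassoc μ) (α β : M) :
    μ (contract v α (μ β)) = TensorProduct.map (contract v α ∘ₗ μ) LinearMap.id (μ β) := by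
  -- Contraction of the first of three factors with `α`; both sides are `C` of an iterated
  -- comultiplication of `β`.
  let C : M ⊗[K] (M ⊗[K] M) →ₗ[K] M ⊗[K] M :=
    (TensorProduct.lid K (M ⊗[K] M)).toLinearMap ∘ₗ
      TensorProduct.map (v ∘ₗ TensorProduct.mk K M M α) LinearMap.id
  have h1 : ∀ z : M ⊗[K] M, μ (contract v α z) = C (TensorProduct.map LinearMap.id μ z) := by
    intro z
    induction z with
    | zero => simp
    | add x y hx hy => simp only [map_add, hx, hy]
    | tmul x y => simp [C, contract_tmul]
  have h2 : ∀ z : M ⊗[K] M, TensorProduct.map (contract v α ∘ₗ μ) LinearMap.id z =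
      C (TensorProduct.assoc K M M M (TensorProduct.map μ LinearMap.id z)) := by
    intro z
    induction z with
    | zero => simp
    | add x y hx hy => simp only [map_add, hx, hy]
    | tmul x y =>
      simp only [TensorProduct.map_tmul, LinearMap.comp_apply, LinearMap.id_apply]
      generalize μ x = w
      induction w with
      | zero => simp
      | add x y hx hy => simp only [map_add, TensorProduct.add_tmul, hx, hy]
      | tmul x y => simp [C, contract_tmul, TensorProduct.smul_tmul']
  rw [h1, h2]
  exact congrArg C (LinearMap.congr_fun hμ β).symm

/-- Both sides are `v(α ⊗ β²) β¹ ⊗ β³ ⊗ β⁴`. This is the coalgebra counterpart of the summand `{a,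
b} c` in the Leibniz rule. -/
theorem comul_vHat_right (hμ : IsCoassoc μ) (α β : M) :
    TensorProduct.map LinearMap.id μ (vHat μ v (α ⊗ₜ β)) =
      TensorProduct.assoc K M M M
        (TensorProduct.map (vHat μ v ∘ₗ TensorProduct.mk K M M α) LinearMap.id (μ β)) := by
  have h1 : ∀ z : M ⊗[K] M, TensorProduct.map LinearMap.id μ
      (TensorProduct.map LinearMap.id (contract v α ∘ₗ μ) z) =
      TensorProduct.map LinearMap.id (TensorProduct.map (contract v α ∘ₗ μ) LinearMap.id)
        (TensorProduct.map LinearMap.id μ z) := by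
    intro z
    induction z with
    | zero => simp
    | add x y hx hy => simp only [map_add, hx, hy]
    | tmul x y => simp [comul_contract hμ]
  have h2 : ∀ z : M ⊗[K] M, TensorProduct.assoc K M M M
      (TensorProduct.map (vHat μ v ∘ₗ TensorProduct.mk K M M α) LinearMap.id z) =
      TensorProduct.map LinearMap.id (TensorProduct.map (contract v α ∘ₗ μ) LinearMap.id)
        (TensorProduct.assoc K M M M (TensorProduct.map μ LinearMap.id z)) := by
    intro z
    induction z with
    | zero => simp
    | add x y hx hy => simp only [map_add, hx, hy]
    | tmul x y =>
      simp only [TensorProduct.map_tmul, LinearMap.comp_apply, LinearMap.id_apply,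
        TensorProduct.mk_apply, vHat_tmul]
      generalize μ x = w
      induction w with
      | zero => simp
      | add x y hx hy => simp only [map_add, TensorProduct.add_tmul, hx, hy]
      | tmul x y => simp
  rw [vHat_tmul, h1, h2]
  exact congrArg _ (LinearMap.congr_fun hμ β).symm

/-- Both sides are `v(α ⊗ β³) β¹ ⊗ β² ⊗ β⁴`. This is the counterpart of the summand `b {a, c}`. -/
theorem comul_vHat_left (hμ : IsCoassoc μ) (α β : M) :
    TensorProduct.assoc K M M M (TensorProduct.map μ LinearMap.id (vHat μ v (α ⊗ₜ β))) =
      TensorProduct.map LinearMap.id (vHat μ v ∘ₗ TensorProduct.mk K M M α) (μ β) := by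
  have h1 : ∀ z : M ⊗[K] M, TensorProduct.assoc K M M M (TensorProduct.map μ LinearMap.id
      (TensorProduct.map LinearMap.id (contract v α ∘ₗ μ) z)) =
      TensorProduct.map LinearMap.id (TensorProduct.map LinearMap.id (contract v α ∘ₗ μ))
        (TensorProduct.assoc K M M M (TensorProduct.map μ LinearMap.id z)) := by
    intro z
    induction z with
    | zero => simp
    | add x y hx hy => simp only [map_add, hx, hy]
    | tmul x y =>
      simp only [TensorProduct.map_tmul, LinearMap.comp_apply, LinearMap.id_apply]
      generalize μ x = w
      induction w with
      | zero => simp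
      | add x y hx hy => simp only [map_add, TensorProduct.add_tmul, hx, hy]
      | tmul x y => simp
  have h2 : ∀ z : M ⊗[K] M,
      TensorProduct.map LinearMap.id (vHat μ v ∘ₗ TensorProduct.mk K M M α) z =
      TensorProduct.map LinearMap.id (TensorProduct.map LinearMap.id (contract v α ∘ₗ μ))
        (TensorProduct.map LinearMap.id μ z) := by
    intro z
    induction z with
    | zero => simp
    | add x y hx hy => simp only [map_add, hx, hy]
    | tmul x y => simp [vHat_tmul]
  rw [vHat_tmul, h1, h2]
  exact congrArg _ (LinearMap.congr_fun hμ β)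

theorem vHat_comm (hv : IsCyclicForm μ v) (α β : M) :
    vHat μ v (β ⊗ₜ α) = TensorProduct.comm K M M (vHat μ v (α ⊗ₜ β)) :=
  LinearMap.congr_fun hv (α ⊗ₜ β)

/-- Inserting `β` and then `α` to its left, or `α` and then `β` to its right, both give `v(α ⊗ γ²)
v(β ⊗ γ⁴) γ¹ ⊗ γ³ ⊗ γ⁵`. -/
theorem vHat_vHat (hμ : IsCoassoc μ) (α β γ : M) :
    TensorProduct.assoc K M M M (TensorProduct.map (vHat μ v ∘ₗ TensorProduct.mk K M M α)
      LinearMap.id (vHat μ v (β ⊗ₜ γ))) =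
    TensorProduct.map LinearMap.id (vHat μ v ∘ₗ TensorProduct.mk K M M β)
      (vHat μ v (α ⊗ₜ γ)) := by
  have h1 : ∀ z : M ⊗[K] M, TensorProduct.assoc K M M M
      (TensorProduct.map (vHat μ v ∘ₗ TensorProduct.mk K M M α) LinearMap.id
        (TensorProduct.map LinearMap.id (contract v β ∘ₗ μ) z)) =
      TensorProduct.map LinearMap.id (TensorProduct.map LinearMap.id (contract v β ∘ₗ μ))
        (TensorProduct.assoc K M M M
          (TensorProduct.map (vHat μ v ∘ₗ TensorProduct.mk K M M α) LinearMap.id z)) := by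
    intro z
    induction z with
    | zero => simp
    | add x y hx hy => simp only [map_add, hx, hy]
    | tmul x y =>
      simp only [TensorProduct.map_tmul, LinearMap.comp_apply, LinearMap.id_apply]
      generalize vHat μ v _ = w
      induction w with
      | zero => simp
      | add x y hx hy => simp only [map_add, TensorProduct.add_tmul, hx, hy]
      | tmul x y => simp
  rw [vHat_tmul β γ, h1, ← comul_vHat_right hμ]
  generalize vHat μ v _ = w
  induction w with
  | zero => simp
  | add x y hx hy => simp only [map_add, hx, hy]
  | tmul x y => simp [vHat_tmul]

/-- The linear map `α ⊗ β ⊗ γ ↦ v (α ⊗ γ²) v (β ⊗ γ⁴) γ¹ ⊗ γ³ ⊗ γ⁵`. -/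
def vHat₃ (μ : M →ₗ[K] M ⊗[K] M) (v : M ⊗[K] M →ₗ[K] K) (α β γ : M) : M ⊗[K] (M ⊗[K] M) :=
  TensorProduct.assoc K M M M (TensorProduct.map (vHat μ v ∘ₗ TensorProduct.mk K M M α)
    LinearMap.id (vHat μ v (β ⊗ₜ γ)))

/-- By `vHat_vHat`, the form for `α, β, γ` applies `v̂(β ⊗ -)` to the second factor of `v̂(α ⊗ γ)`.
By cyclicity that factor is the first factor of `v̂(γ ⊗ α)`, where the form for `β, γ, α` applies
`v̂(β ⊗ -)`. -/
theorem vHat₃_cyclic (hμ : IsCoassoc μ) (hv : IsCyclicForm μ v) (α β γ : M) :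
    vHat₃ μ v β γ α =
      TensorProduct.assoc K M M M (TensorProduct.comm K M (M ⊗[K] M) (vHat₃ μ v α β γ)) := by
  rw [vHat₃, vHat₃, vHat_vHat hμ α β γ, vHat_comm hv α γ]
  generalize vHat μ v _ = w
  induction w with
  | zero => simp
  | add x y hx hy => simp only [map_add, hx, hy]
  | tmul x y => simp

end CyclicForms

/-! ### Products of families of generators -/

section ProdMap

variable {K M₁ M₂ M₃ B : Type*} [CommRing K] [AddCommGroup M₁] [Module K M₁] [AddCommGroup M₂]
  [Module K M₂] [AddCommGroup M₃] [Module K M₃] [NonUnitalRing B] [Module K B]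
  [IsScalarTower K B B] [SMulCommClass K B B]

theorem prodMap_assoc (f : M₁ →ₗ[K] B) (g : M₂ →ₗ[K] B) (k : M₃ →ₗ[K] B)
    (z : (M₁ ⊗[K] M₂) ⊗[K] M₃) :
    prodMap f (prodMap g k) (TensorProduct.assoc K M₁ M₂ M₃ z) = prodMap (prodMap f g) k z := by
  induction z with
  | zero => simp
  | add x y hx hy => simp only [map_add, hx, hy]
  | tmul x y =>
    induction x with
    | zero => simp
    | add x y hx hy => simp only [map_add, TensorProduct.add_tmul, hx, hy]
    | tmul x z => simp [mul_assoc]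

theorem prodMap_map {M₄ : Type*} [AddCommGroup M₄] [Module K M₄] (f : M₁ →ₗ[K] B)
    (g : M₂ →ₗ[K] B) (h : M₃ →ₗ[K] M₁) (k : M₄ →ₗ[K] M₂) (z : M₃ ⊗[K] M₄) :
    prodMap f g (TensorProduct.map h k z) = prodMap (f ∘ₗ h) (g ∘ₗ k) z := by
  induction z with
  | zero => simp
  | add x y hx hy => simp only [map_add, hx, hy]
  | tmul x y => simp

end ProdMap

/-! ### The bracket on generators -/

section Induced

variable {K A M : Type*} [CommRing K] [NonUnitalRing A] [Module K A]
  [AddCommGroup M] [Module K M]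
variable {𝒜 : ℤ → Submodule K A} {μ : M →ₗ[K] M ⊗[K] M}

theorem genMul_tmul (x y : A) (S : M ⊗[K] M) : genMul 𝒜 μ ((x ⊗ₜ y) ⊗ₜ S) =
    prodMap (gen 𝒜 μ ∘ₗ TensorProduct.mk K A M x) (gen 𝒜 μ ∘ₗ TensorProduct.mk K A M y) S := by
  induction S with
  | zero => simp
  | add x y hx hy => simp only [map_add, TensorProduct.tmul_add, hx, hy]
  | tmul x y => simp [genMul]

theorem genMul_tmul_tmul (x y : A) (φ ψ : M) : genMul 𝒜 μ ((x ⊗ₜ y) ⊗ₜ (φ ⊗ₜ ψ)) =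
    gen 𝒜 μ (x ⊗ₜ φ) * gen 𝒜 μ (y ⊗ₜ ψ) := by
  simp [genMul]

theorem tensor_homogeneous_induction [DirectSum.Decomposition 𝒜] {P : A ⊗[K] A → Prop}
    (zero : P 0) (add : ∀ x y, P x → P y → P (x + y))
    (tmul : ∀ p q, ∀ a ∈ 𝒜 p, ∀ b ∈ 𝒜 q, P (a ⊗ₜ b)) (W : A ⊗[K] A) : P W := by
  induction W with
  | zero => exact zero
  | add x y hx hy => exact add x y hx hy
  | tmul a b =>
    induction a using DirectSum.Decomposition.inductionOn 𝒜 with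
    | zero => simpa using zero
    | add x y hx hy => rw [TensorProduct.add_tmul]; exact add _ _ hx hy
    | @homogeneous p a =>
      induction b using DirectSum.Decomposition.inductionOn 𝒜 with
      | zero => simpa using zero
      | add x y hx hy => rw [TensorProduct.tmul_add]; exact add _ _ hx hy
      | @homogeneous q b => exact tmul p q a a.2 b b.2

theorem tmul_negOnePow_smul {X Y : Type*} [AddCommGroup X] [Module K X] [AddCommGroup Y]
    [Module K Y] (k : ℤ) (x : X) (y : Y) :
    (k.negOnePow • x) ⊗ₜ[K] y = k.negOnePow • (x ⊗ₜ[K] y) := by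
  rw [negOnePow_eq_ite]
  split_ifs <;> simp [TensorProduct.neg_tmul]

/-- The sign of `P_{21}` is the sign of commuting `x_φ` with `y_ψ` in `A_M`, so flipping both
tensors changes nothing. -/
theorem genMul_flip [DirectSum.Decomposition 𝒜] (W : A ⊗[K] A) (S : M ⊗[K] M) :
    genMul 𝒜 μ (flip21 𝒜 0 W ⊗ₜ TensorProduct.comm K M M S) = genMul 𝒜 μ (W ⊗ₜ S) := by
  induction W using tensor_homogeneous_induction (𝒜 := 𝒜) with
  | zero => simp
  | add x y hx hy => simp only [map_add, TensorProduct.add_tmul, hx, hy]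
  | tmul p q a ha b hb =>
    rw [flip21_tmul 𝒜 ha hb, tmul_negOnePow_smul, linearMap_negOnePow_smul]
    induction S with
    | zero => simp
    | add x y hx hy => simp only [map_add, TensorProduct.tmul_add, smul_add, hx, hy]
    | tmul x y =>
      rw [TensorProduct.comm_tmul, genMul_tmul_tmul, genMul_tmul_tmul, gen_comm 𝒜 μ ha hb]
      simp

theorem genMul_mem {d : ℤ} {W : A ⊗[K] A} (hW : W ∈ tensorDegree 𝒜 d) (S : M ⊗[K] M) :
    genMul 𝒜 μ (W ⊗ₜ S) ∈ repGrading 𝒜 μ d := by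
  induction hW using Submodule.span_induction with
  | zero => simp
  | add x y _ _ hx hy => rw [TensorProduct.add_tmul, map_add]; exact add_mem hx hy
  | smul k x _ h =>
    rw [← TensorProduct.smul_tmul', map_smul]; exact Submodule.smul_mem _ _ h
  | mem W h =>
    obtain ⟨i, j, rfl, x, hx, y, hy, rfl⟩ := h
    induction S with
    | zero => simp
    | add x y hx hy => rw [TensorProduct.tmul_add, map_add]; exact add_mem hx hy
    | tmul φ ψ =>
      rw [genMul_tmul_tmul]
      exact repGrading_mul 𝒜 μ (gen_mem 𝒜 μ hx φ) (gen_mem 𝒜 μ hy ψ)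


variable [IsScalarTower K A A] in
-- Expanding `(yc)_ψ` comultiplies the second factor of `v̂(α ⊗ β)`, and `comul_vHat_right` rewrites
-- the result with `μ β`.
theorem genMul_outerR {v : M ⊗[K] M →ₗ[K] K} (hμ : IsCoassoc μ) (c : A) (W : A ⊗[K] A) (α β : M) :
    genMul 𝒜 μ (outerR c W ⊗ₜ vHat μ v (α ⊗ₜ β)) =
      prodMap (genMul 𝒜 μ ∘ₗ TensorProduct.mk K _ _ W ∘ₗ vHat μ v ∘ₗ TensorProduct.mk K M M α)
        (gen 𝒜 μ ∘ₗ TensorProduct.mk K A M c) (μ β) := by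
  induction W with
  | zero =>
    simp [prodMap]
  | add x y hx hy =>
    simp only [prodMap, map_add, TensorProduct.add_tmul, hx, hy, LinearMap.add_comp,
      LinearMap.comp_add, TensorProduct.map_add_left, LinearMap.add_apply]
  | tmul x y =>
    have h1 : gen 𝒜 μ ∘ₗ TensorProduct.mk K A M (y * c) =
        prodMap (gen 𝒜 μ ∘ₗ TensorProduct.mk K A M y) (gen 𝒜 μ ∘ₗ TensorProduct.mk K A M c) ∘ₗ
          μ := by
      ext α; exact gen_mul 𝒜 μ y c α
    have h2 : genMul 𝒜 μ ∘ₗ TensorProduct.mk K (A ⊗[K] A) (M ⊗[K] M) (x ⊗ₜ y) ∘ₗ vHat μ v ∘ₗ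
        TensorProduct.mk K M M α =
        prodMap (gen 𝒜 μ ∘ₗ TensorProduct.mk K A M x) (gen 𝒜 μ ∘ₗ TensorProduct.mk K A M y) ∘ₗ
          vHat μ v ∘ₗ TensorProduct.mk K M M α :=
      LinearMap.ext fun S => genMul_tmul x y _
    have h3 := comul_vHat_right (v := v) hμ α β
    simp only [outerR, TensorProduct.map_tmul, LinearMap.id_apply, LinearMap.mulRight_apply]
    rw [genMul_tmul, h1, h2]
    rw [← LinearMap.comp_id (gen 𝒜 μ ∘ₗ TensorProduct.mk K A M x), ← prodMap_map, h3,
      prodMap_assoc, prodMap_map]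
    rfl

variable [SMulCommClass K A A] in
-- Same argument on the first factor, with `comul_vHat_left`.
theorem genMul_outerL {v : M ⊗[K] M →ₗ[K] K} (hμ : IsCoassoc μ) (b : A) (W : A ⊗[K] A) (α β : M) :
    genMul 𝒜 μ (outerL b W ⊗ₜ vHat μ v (α ⊗ₜ β)) =
      prodMap (gen 𝒜 μ ∘ₗ TensorProduct.mk K A M b)
        (genMul 𝒜 μ ∘ₗ TensorProduct.mk K _ _ W ∘ₗ vHat μ v ∘ₗ TensorProduct.mk K M M α)
        (μ β) := by
  induction W with
  | zero =>
    simp [prodMap]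
  | add x y hx hy =>
    simp only [prodMap, map_add, TensorProduct.add_tmul, hx, hy, LinearMap.add_comp,
      LinearMap.comp_add, TensorProduct.map_add_right, LinearMap.add_apply]
  | tmul x y =>
    have h1 : gen 𝒜 μ ∘ₗ TensorProduct.mk K A M (b * x) =
        prodMap (gen 𝒜 μ ∘ₗ TensorProduct.mk K A M b) (gen 𝒜 μ ∘ₗ TensorProduct.mk K A M x) ∘ₗ
          μ := by
      ext α; exact gen_mul 𝒜 μ b x α
    have h2 : genMul 𝒜 μ ∘ₗ TensorProduct.mk K (A ⊗[K] A) (M ⊗[K] M) (x ⊗ₜ y) ∘ₗ vHat μ v ∘ₗ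
        TensorProduct.mk K M M α =
        prodMap (gen 𝒜 μ ∘ₗ TensorProduct.mk K A M x) (gen 𝒜 μ ∘ₗ TensorProduct.mk K A M y) ∘ₗ
          vHat μ v ∘ₗ TensorProduct.mk K M M α :=
      LinearMap.ext fun S => genMul_tmul x y _
    have h3 := comul_vHat_left (v := v) hμ α β
    simp only [outerL, TensorProduct.map_tmul, LinearMap.id_apply, LinearMap.mulLeft_apply]
    rw [genMul_tmul, h1, h2]
    rw [← LinearMap.comp_id (gen 𝒜 μ ∘ₗ TensorProduct.mk K A M y), ← prodMap_map,
      ← prodMap_assoc, h3, prodMap_map]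
    rfl

variable (𝒜 μ) in
/-- The values of the induced bracket on the generators. -/
def genBracket (v : M ⊗[K] M →ₗ[K] K) (db : A ⊗[K] A →ₗ[K] A ⊗[K] A) :
    A ⊗[K] M →ₗ[K] A ⊗[K] M →ₗ[K] RepAlg 𝒜 μ :=
  TensorProduct.curry (genMul 𝒜 μ ∘ₗ TensorProduct.map db (vHat μ v) ∘ₗ
    (TensorProduct.tensorTensorTensorComm K A M A M).toLinearMap)

theorem genBracket_tmul (v : M ⊗[K] M →ₗ[K] K) (db : A ⊗[K] A →ₗ[K] A ⊗[K] A) (a b : A) (α β : M) :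
    genBracket 𝒜 μ v db (a ⊗ₜ α) (b ⊗ₜ β) =
      genMul 𝒜 μ (db (a ⊗ₜ b) ⊗ₜ vHat μ v (α ⊗ₜ β)) := by
  simp [genBracket]

variable {v : M ⊗[K] M →ₗ[K] K} {n : ℤ} {db : A ⊗[K] A →ₗ[K] A ⊗[K] A}

variable [IsScalarTower K A A] [SMulCommClass K A A]

/-- The two summands of the Leibniz rule of the double bracket become, by `genMul_outerR` and
`genMul_outerL`, those required of a derivation on generators. -/
theorem genBracket_mem [DirectSum.Decomposition 𝒜] (hdb : IsDoubleBracket 𝒜 n db)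
    (hμ : IsCoassoc μ) {p : ℤ} {a : A} (ha : a ∈ 𝒜 p) (α : M) :
    genBracket 𝒜 μ v db (a ⊗ₜ α) ∈ genDer 𝒜 μ (p + n) := by
  have h : ∀ b, genBracket 𝒜 μ v db (a ⊗ₜ α) ∘ₗ TensorProduct.mk K A M b =
      genMul 𝒜 μ ∘ₗ TensorProduct.mk K _ _ (db (a ⊗ₜ b)) ∘ₗ vHat μ v ∘ₗ
        TensorProduct.mk K M M α := by
    intro b
    ext β
    exact genBracket_tmul v db a b α β
  refine ⟨fun q b hb β => ?_, fun q r b hb c hc β => ?_⟩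
  · rw [genBracket_tmul, ← add_assoc, add_comm q p]
    exact genMul_mem (hdb.graded p q a ha b hb) _
  · rw [genBracket_tmul, hdb.leibniz_right p q r a ha b hb c hc, TensorProduct.add_tmul, map_add,
      genMul_outerR hμ, tmul_negOnePow_smul, linearMap_negOnePow_smul, genMul_outerL hμ, h, h]

/-- Antisymmetry of the double bracket flips the `A` factors and cyclicity of `v` flips the `M`
factors; `genMul_flip` cancels the two flips. -/
theorem genBracket_antisymm [DirectSum.Decomposition 𝒜] (hdb : IsDoubleBracket 𝒜 n db)
    (hv : IsCyclicForm μ v) {p q : ℤ} {a b : A} (ha : a ∈ 𝒜 p) (hb : b ∈ 𝒜 q) (α β : M) :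
    genBracket 𝒜 μ v db (a ⊗ₜ α) (b ⊗ₜ β) =
      -(((p + n) * (q + n)).negOnePow • genBracket 𝒜 μ v db (b ⊗ₜ β) (a ⊗ₜ α)) := by
  have h := LinearMap.congr_fun hdb.antisymm (a ⊗ₜ b)
  simp only [LinearMap.comp_apply, LinearEquiv.coe_coe, flip21_tmul 𝒜 ha hb, LinearMap.neg_apply,
    linearMap_negOnePow_smul] at h
  rw [genBracket_tmul, genBracket_tmul, vHat_comm hv α β, ← linearMap_negOnePow_smul,
    ← tmul_negOnePow_smul, h, TensorProduct.neg_tmul, map_neg, genMul_flip, neg_neg]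

end Induced

/-! ### Construction and uniqueness of the induced biderivation -/

section Biderivation

variable {K A M : Type*} [CommRing K] [NonUnitalRing A] [Module K A]
  [AddCommGroup M] [Module K M]
variable {𝒜 : ℤ → Submodule K A} {μ : M →ₗ[K] M ⊗[K] M}

theorem negOnePow_congr {k l : ℤ} (m : ℤ) (h : k = l + (m + m)) : k.negOnePow = l.negOnePow := by
  rw [h, Int.negOnePow_add, Int.negOnePow_even _ ⟨m, rfl⟩, mul_one]

/-- Graded commutativity moves `u` past `x` in `u x D(y)`, and the sign produced accounts for the
change of degree from `d` to `e + d`. -/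
theorem mulLeft_comp_mem_gradedDer {d e : ℤ} {u : RepAlg 𝒜 μ} (hu : u ∈ repGrading 𝒜 μ e)
    {D : RepAlg 𝒜 μ →ₗ[K] RepAlg 𝒜 μ} (hD : D ∈ gradedDer 𝒜 μ d) :
    LinearMap.mulLeft K u ∘ₗ D ∈ gradedDer 𝒜 μ (e + d) := by
  refine ⟨fun p x hx => ?_, fun p q x hx y hy => ?_⟩
  · have := repGrading_mul 𝒜 μ hu (hD.1 p x hx)
    rwa [← add_assoc, add_comm e p, add_assoc] at this
  · simp only [LinearMap.comp_apply, LinearMap.mulLeft_apply, gradedDer_mul hD hx hy, mul_add,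
      mul_smul_comm]
    rw [← mul_assoc, ← mul_assoc, ← mul_assoc, repGrading_comm 𝒜 μ hu hx, smul_mul_assoc,
      smul_smul, ← Int.negOnePow_add, add_mul, add_comm (d * p)]

theorem IsBiderivation.mem_gradedDer {n : ℤ}
    {br : RepAlg 𝒜 μ →ₗ[K] RepAlg 𝒜 μ →ₗ[K] RepAlg 𝒜 μ}
    (h : IsBiderivation (repGrading 𝒜 μ) n br) {p : ℤ} {a : RepAlg 𝒜 μ}
    (ha : a ∈ repGrading 𝒜 μ p) : br a ∈ gradedDer 𝒜 μ (p + n) := by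
  refine ⟨fun q b hb => ?_, fun q r b hb c hc => h.leibniz_right p q r a ha b hb c hc⟩
  have := h.graded p q a ha b hb
  rwa [add_comm p q, add_assoc] at this

/-- Derivations are determined on generators. This settles a generator in the first slot;
antisymmetry then reduces an arbitrary first slot to that case. -/
theorem IsBiderivation.ext [DirectSum.Decomposition 𝒜] {n : ℤ}
    {br br' : RepAlg 𝒜 μ →ₗ[K] RepAlg 𝒜 μ →ₗ[K] RepAlg 𝒜 μ}
    (h : IsBiderivation (repGrading 𝒜 μ) n br) (h' : IsBiderivation (repGrading 𝒜 μ) n br')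
    (hgen : ∀ p q, ∀ a ∈ 𝒜 p, ∀ b ∈ 𝒜 q, ∀ α β, br (gen 𝒜 μ (a ⊗ₜ α)) (gen 𝒜 μ (b ⊗ₜ β)) =
      br' (gen 𝒜 μ (a ⊗ₜ α)) (gen 𝒜 μ (b ⊗ₜ β))) : br = br' := by
  have h1 : ∀ p, ∀ a ∈ 𝒜 p, ∀ α, br (gen 𝒜 μ (a ⊗ₜ α)) = br' (gen 𝒜 μ (a ⊗ₜ α)) :=
    fun p a ha α => gradedDer_ext (h.mem_gradedDer (gen_mem 𝒜 μ ha α))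
      (h'.mem_gradedDer (gen_mem 𝒜 μ ha α)) fun q b hb β => hgen p q a ha b hb α β
  refine repAlg_linear_ext fun p x hx => ?_
  refine gradedDer_ext (h.mem_gradedDer hx) (h'.mem_gradedDer hx) fun q b hb β => ?_
  rw [h.antisymm p q x hx _ (gen_mem 𝒜 μ hb β), h'.antisymm p q x hx _ (gen_mem 𝒜 μ hb β),
    h1 q b hb β]

variable [DirectSum.Decomposition 𝒜] [IsScalarTower K A A] [SMulCommClass K A A]
  [SetLike.GradedMul 𝒜]

/-- The linear family of graded derivations with given restrictions to the generators. -/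
def derOfGen {X : Type*} [AddCommGroup X] [Module K X] {d : ℤ}
    (E : X →ₗ[K] A ⊗[K] M →ₗ[K] RepAlg 𝒜 μ) (hE : ∀ x, E x ∈ genDer 𝒜 μ d) :
    X →ₗ[K] RepAlg 𝒜 μ →ₗ[K] RepAlg 𝒜 μ :=
  (gradedDer 𝒜 μ d).subtype ∘ₗ (gradedDerEquiv 𝒜 μ d).symm.toLinearMap ∘ₗ
    E.codRestrict (genDer 𝒜 μ d) hE

theorem derOfGen_mem {X : Type*} [AddCommGroup X] [Module K X] {d : ℤ}
    (E : X →ₗ[K] A ⊗[K] M →ₗ[K] RepAlg 𝒜 μ) (hE : ∀ x, E x ∈ genDer 𝒜 μ d) (x : X) :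
    derOfGen E hE x ∈ gradedDer 𝒜 μ d := Subtype.prop _

theorem derOfGen_gen {X : Type*} [AddCommGroup X] [Module K X] {d : ℤ}
    (E : X →ₗ[K] A ⊗[K] M →ₗ[K] RepAlg 𝒜 μ) (hE : ∀ x, E x ∈ genDer 𝒜 μ d) (x : X)
    (z : A ⊗[K] M) : derOfGen E hE x (gen 𝒜 μ z) = E x z :=
  gradedDerEquiv_symm_gen 𝒜 μ _ z

variable {v : M ⊗[K] M →ₗ[K] K} {n : ℤ} {db : A ⊗[K] A →ₗ[K] A ⊗[K] A}

/-- The degree of the derivation `{a_α, -}` depends on `a`, so the extension is made for each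
homogeneous part of `A` separately and then assembled linearly. -/
theorem exists_bracket_gen_left (hdb : IsDoubleBracket 𝒜 n db) (hμ : IsCoassoc μ) :
    ∃ Φ : A ⊗[K] M →ₗ[K] RepAlg 𝒜 μ →ₗ[K] RepAlg 𝒜 μ,
      (∀ p, ∀ a ∈ 𝒜 p, ∀ α, Φ (a ⊗ₜ α) ∈ gradedDer 𝒜 μ (p + n)) ∧
      ∀ z w, Φ z (gen 𝒜 μ w) = genBracket 𝒜 μ v db z w := by
  have hE : ∀ p : ℤ, ∀ x : 𝒜 p ⊗[K] M, (genBracket 𝒜 μ v db ∘ₗ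
      TensorProduct.map (𝒜 p).subtype LinearMap.id) x ∈ genDer 𝒜 μ (p + n) := by
    intro p x
    induction x with
    | zero => simp
    | add x y hx hy => rw [map_add]; exact add_mem hx hy
    | tmul a α => exact genBracket_mem hdb hμ a.2 α
  let Φ : A ⊗[K] M →ₗ[K] RepAlg 𝒜 μ →ₗ[K] RepAlg 𝒜 μ := TensorProduct.lift <|
    gradedLift 𝒜 fun p => TensorProduct.curry (derOfGen _ (hE p))
  have hΦ : ∀ p, ∀ a, ∀ ha : a ∈ 𝒜 p, ∀ α, Φ (a ⊗ₜ α) = derOfGen _ (hE p) (⟨a, ha⟩ ⊗ₜ α) := by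
    intro p a ha α
    simp only [Φ, TensorProduct.lift.tmul, gradedLift_of_mem 𝒜 _ ha, TensorProduct.curry_apply]
  refine ⟨Φ, fun p a ha α => ?_, fun z w => ?_⟩
  · rw [hΦ p a ha]
    exact derOfGen_mem _ _ _
  · refine LinearMap.congr_fun (f := (LinearMap.applyₗ (gen 𝒜 μ w)) ∘ₗ Φ)
      (g := (genBracket 𝒜 μ v db).flip w) (tensor_graded_ext 𝒜 fun p a ha α => ?_) z
    simp only [LinearMap.comp_apply, LinearMap.applyₗ_apply_apply, hΦ p a ha, derOfGen_gen]
    rfl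

theorem exists_induced_bracket (hdb : IsDoubleBracket 𝒜 n db) (hμ : IsCoassoc μ)
    (hv : IsCyclicForm μ v) :
    ∃ br : RepAlg 𝒜 μ →ₗ[K] RepAlg 𝒜 μ →ₗ[K] RepAlg 𝒜 μ,
      IsBiderivation (repGrading 𝒜 μ) n br ∧ IsInducedOnGen 𝒜 μ v db br := by
  obtain ⟨Φ, hΦ, hΦgen⟩ := exists_bracket_gen_left (v := v) hdb hμ
  -- `E p u` is the only possible restriction of `{u, -}` to generators when `u` has degree `p`:
  -- antisymmetry expresses `{u, b_β}` through `{b_β, u}`.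
  let E : ℤ → RepAlg 𝒜 μ →ₗ[K] A ⊗[K] M →ₗ[K] RepAlg 𝒜 μ := fun p =>
    -(LinearMap.lcomp K (RepAlg 𝒜 μ)
      (TensorProduct.map (signOp 𝒜 n (p + n)) (LinearMap.id (R := K) (M := M))) ∘ₗ Φ.flip)
  have hEapp : ∀ p q, ∀ b ∈ 𝒜 q, ∀ β u, E p u (b ⊗ₜ β) =
      -(((p + n) * (q + n)).negOnePow • Φ (b ⊗ₜ β) u) := by
    intro p q b hb β u
    simp only [E, LinearMap.neg_apply, LinearMap.comp_apply, LinearMap.lcomp_apply,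
      TensorProduct.map_tmul, signOp_of_mem 𝒜 hb, LinearMap.id_apply, tmul_negOnePow_smul,
      LinearMap.flip_apply, linearMap_negOnePow_smul]
    rfl
  have hEgen : ∀ p, ∀ a ∈ 𝒜 p, ∀ α, E p (gen 𝒜 μ (a ⊗ₜ α)) = genBracket 𝒜 μ v db (a ⊗ₜ α) := by
    intro p a ha α
    refine tensor_graded_ext 𝒜 fun q b hb β => ?_
    rw [hEapp p q b hb, hΦgen, genBracket_antisymm hdb hv ha hb]
  -- The left Leibniz rule in the form `{uw, -} = u {w, -} + (-1)^(pp') w {u, -}`. With both factors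
  -- on the left, the sign no longer depends on the other argument.
  have hEmul : ∀ p p' u w, u ∈ repGrading 𝒜 μ p → w ∈ repGrading 𝒜 μ p' →
      ∀ D D' : RepAlg 𝒜 μ →ₗ[K] RepAlg 𝒜 μ, D ∘ₗ gen 𝒜 μ = E p u → D' ∘ₗ gen 𝒜 μ = E p' w →
      E (p + p') (u * w) = (LinearMap.mulLeft K u ∘ₗ D' +
        (p * p').negOnePow • (LinearMap.mulLeft K w ∘ₗ D)) ∘ₗ gen 𝒜 μ := by
    intro p p' u w hu hw D D' hD hD'
    refine tensor_graded_ext 𝒜 fun q b hb β => ?_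
    have h1 := LinearMap.congr_fun hD (b ⊗ₜ β)
    have h2 := LinearMap.congr_fun hD' (b ⊗ₜ β)
    rw [LinearMap.comp_apply, hEapp _ q b hb] at h1 h2
    have h3 : (Φ (b ⊗ₜ β)) u * w = ((p + (q + n)) * p').negOnePow • (w * Φ (b ⊗ₜ β) u) :=
      repGrading_comm 𝒜 μ ((hΦ q b hb β).1 p u hu) hw
    rw [hEapp _ q b hb, gradedDer_mul (hΦ q b hb β) hu hw, h3]
    simp only [LinearMap.comp_apply, LinearMap.add_apply, LinearMap.smul_apply,
      LinearMap.mulLeft_apply, h1, h2, mul_neg, smul_neg, smul_add, smul_smul, neg_add,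
      mul_smul_comm, ← Int.negOnePow_add]
    rw [add_comm]
    congr 3
    · exact negOnePow_congr (p * (q + n)) (by ring)
    · exact negOnePow_congr (p' * (q + n)) (by ring)
  have hE : ∀ p, ∀ u ∈ repGrading 𝒜 μ p, E p u ∈ genDer 𝒜 μ (p + n) := by
    intro p u hu
    induction hu using homogeneous_induction with
    | zero => simp
    | add p x y _ _ h h' => rw [map_add]; exact add_mem h h'
    | smul k p x _ h => rw [map_smul]; exact Submodule.smul_mem _ k h
    | gen p a ha α => rw [hEgen p a ha]; exact genBracket_mem hdb hμ ha α
    | mul p p' u w hu hw h h' =>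
      -- By induction `E p u` and `E p' w` extend to derivations, so `hEmul` presents the new map as
      -- the restriction of a combination of left multiples of derivations.
      obtain ⟨D, hD, hDg⟩ := exists_gradedDer h
      obtain ⟨D', hD', hDg'⟩ := exists_gradedDer h'
      rw [hEmul p p' u w hu hw D D' hDg hDg']
      refine restrict_mem_genDer (add_mem ?_ (negOnePow_smul_mem _ ?_))
      · have := mulLeft_comp_mem_gradedDer hu hD'
        rwa [← add_assoc] at this
      · have := mulLeft_comp_mem_gradedDer hw hD
        rwa [← add_assoc, add_comm p' p] at this
  let _ : DirectSum.Decomposition (repGrading 𝒜 μ) :=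
    (repGrading_isInternal 𝒜 μ).chooseDecomposition
  let br : RepAlg 𝒜 μ →ₗ[K] RepAlg 𝒜 μ →ₗ[K] RepAlg 𝒜 μ :=
    gradedLift (repGrading 𝒜 μ) fun p =>
      derOfGen (E p ∘ₗ (repGrading 𝒜 μ p).subtype) fun u => hE p u u.2
  have hbr : ∀ p, ∀ u, ∀ hu : u ∈ repGrading 𝒜 μ p, br u =
      derOfGen (E p ∘ₗ (repGrading 𝒜 μ p).subtype) (fun u => hE p u u.2) ⟨u, hu⟩ :=
    fun p u hu => gradedLift_of_mem _ _ hu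
  have hder : ∀ p, ∀ u ∈ repGrading 𝒜 μ p, br u ∈ gradedDer 𝒜 μ (p + n) := by
    intro p u hu
    rw [hbr p u hu]
    exact derOfGen_mem _ _ _
  have hbrE : ∀ p, ∀ u ∈ repGrading 𝒜 μ p, br u ∘ₗ gen 𝒜 μ = E p u := by
    intro p u hu
    rw [hbr p u hu]
    exact LinearMap.ext fun z => derOfGen_gen _ _ _ z
  -- The derivation built from antisymmetry agrees with the one built directly when the first
  -- argument is a generator, since both have the prescribed values on generators.
  have hbrΦ : ∀ z, br (gen 𝒜 μ z) = Φ z := by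
    refine fun z => LinearMap.congr_fun (f := br ∘ₗ gen 𝒜 μ) (g := Φ)
      (tensor_graded_ext 𝒜 fun p a ha α => ?_) z
    refine gradedDer_ext (hder p _ (gen_mem 𝒜 μ ha α)) (hΦ p a ha α) fun q b hb β => ?_
    have := LinearMap.congr_fun (hbrE p _ (gen_mem 𝒜 μ ha α)) (b ⊗ₜ β)
    rw [LinearMap.comp_apply, hEgen p a ha] at this
    exact this.trans (hΦgen _ _).symm
  have hbrmul : ∀ p p' u w, u ∈ repGrading 𝒜 μ p → w ∈ repGrading 𝒜 μ p' →
      br (u * w) = LinearMap.mulLeft K u ∘ₗ br w +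
        (p * p').negOnePow • (LinearMap.mulLeft K w ∘ₗ br u) := by
    intro p p' u w hu hw
    refine gradedDer_ext (hder _ _ (repGrading_mul 𝒜 μ hu hw))
      (add_mem ?_ (negOnePow_smul_mem _ ?_)) fun q b hb β => ?_
    · have := mulLeft_comp_mem_gradedDer hu (hder p' w hw)
      rwa [← add_assoc] at this
    · have := mulLeft_comp_mem_gradedDer hw (hder p u hu)
      rwa [← add_assoc, add_comm p' p] at this
    · have := hEmul p p' u w hu hw _ _ (hbrE p u hu) (hbrE p' w hw)
      rw [← hbrE _ _ (repGrading_mul 𝒜 μ hu hw)] at this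
      exact LinearMap.congr_fun this (b ⊗ₜ β)
  have hleft : ∀ p q r : ℤ, ∀ a ∈ repGrading 𝒜 μ p, ∀ b ∈ repGrading 𝒜 μ q,
      ∀ c ∈ repGrading 𝒜 μ r,
      br (a * b) c = a * br b c + (q * (r + n)).negOnePow • (br a c * b) := by
    intro p q r a ha b hb c hc
    rw [hbrmul p q a b ha hb, repGrading_comm 𝒜 μ ((hder p a ha).1 r c hc) hb, smul_smul,
      ← Int.negOnePow_add]
    simp only [LinearMap.add_apply, LinearMap.comp_apply, LinearMap.mulLeft_apply,
      LinearMap.smul_apply]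
    congr 2
    exact negOnePow_congr (-(q * (r + n))) (by ring)
  refine ⟨br, ⟨fun p q a ha b hb => ?_, fun p q r a ha b hb c hc => ?_, hleft, ?_⟩,
    fun a b α β => ?_⟩
  · have := (hder p a ha).1 q b hb
    rwa [← add_assoc, add_comm q p] at this
  · exact gradedDer_mul (hder p a ha) hb hc
  -- Antisymmetry by induction on the second argument: for a generator it is the definition of `E`,
  -- and for a product the right and left Leibniz rules correspond term by term.
  · intro p q a ha b hb
    induction hb using homogeneous_induction with
    | zero => simp
    | add q x y _ _ h h' => simp only [map_add, LinearMap.add_apply, h, h', smul_add, neg_add]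
    | smul k q x _ h => simp only [map_smul, LinearMap.smul_apply, h, smul_neg, smul_comm k]
    | gen q b hb β =>
      rw [hbrΦ, ← hEapp p q b hb, ← hbrE p a ha]
      rfl
    | mul q q' x y hx hy h h' =>
      rw [gradedDer_mul (hder p a ha) hx hy, hleft q q' p x hx y hy a ha, h, h', smul_add,
        neg_add, add_comm]
      simp only [neg_mul, mul_neg, smul_neg, smul_mul_assoc, mul_smul_comm, smul_smul,
        ← Int.negOnePow_add]
      congr 3
      · exact negOnePow_congr 0 (by ring)
      · exact negOnePow_congr (-(q' * (p + n))) (by ring)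
  · rw [hbrΦ, hΦgen, genBracket_tmul]

end Biderivation

/-! ### The Jacobi identity -/

section Jacobi

variable {K A M : Type*} [CommRing K] [NonUnitalRing A] [Module K A]
  [AddCommGroup M] [Module K M]
variable {𝒜 : ℤ → Submodule K A} {μ : M →ₗ[K] M ⊗[K] M}

/-- The mixed terms `D x * E y` and `E x * D y` occur in both compositions and cancel with the sign
`(-1)^(de)`. -/
theorem gradedDer_commutator {d e : ℤ} {D E : RepAlg 𝒜 μ →ₗ[K] RepAlg 𝒜 μ}
    (hD : D ∈ gradedDer 𝒜 μ d) (hE : E ∈ gradedDer 𝒜 μ e) :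
    D ∘ₗ E - (d * e).negOnePow • (E ∘ₗ D) ∈ gradedDer 𝒜 μ (d + e) := by
  refine ⟨fun p x hx => sub_mem ?_ (negOnePow_smul_mem _ ?_), fun p q x hx y hy => ?_⟩
  · have := hD.1 _ _ (hE.1 p x hx)
    rwa [add_assoc, add_comm e] at this
  · have := hE.1 _ _ (hD.1 p x hx)
    rwa [add_assoc] at this
  · have h1 : D (E (x * y)) = D (E x) * y + (d * (p + e)).negOnePow • (E x * D y) +
        (e * p).negOnePow • (D x * E y) + ((d + e) * p).negOnePow • (x * D (E y)) := by
      rw [gradedDer_mul hE hx hy, map_add, gradedDer_mul hD (hE.1 p x hx) hy,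
        linearMap_negOnePow_smul, gradedDer_mul hD hx (hE.1 q y hy), smul_add, smul_smul,
        ← Int.negOnePow_add, add_mul, add_comm (d * p)]
      abel
    have h2 : E (D (x * y)) = E (D x) * y + (e * (p + d)).negOnePow • (D x * E y) +
        (d * p).negOnePow • (E x * D y) + ((d + e) * p).negOnePow • (x * E (D y)) := by
      rw [gradedDer_mul hD hx hy, map_add, gradedDer_mul hE (hD.1 p x hx) hy,
        linearMap_negOnePow_smul, gradedDer_mul hE hx (hD.1 q y hy), smul_add, smul_smul,
        ← Int.negOnePow_add, add_mul]
      abel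
    have h3 : (d * e + e * (p + d)).negOnePow = (e * p).negOnePow :=
      negOnePow_congr (d * e) (by ring)
    have h4 : (d * e + d * p).negOnePow = (d * (p + e)).negOnePow :=
      negOnePow_congr 0 (by ring)
    simp only [LinearMap.sub_apply, LinearMap.comp_apply, LinearMap.smul_apply, h1, h2, smul_add,
      smul_smul, sub_mul, mul_sub, smul_sub, ← Int.negOnePow_add, h3, h4, smul_mul_assoc,
      mul_smul_comm, add_comm (d * e) ((d + e) * p)]
    abel

variable {n : ℤ} {br : RepAlg 𝒜 μ →ₗ[K] RepAlg 𝒜 μ →ₗ[K] RepAlg 𝒜 μ}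

variable (n br) in
/-- The left-hand side of the graded Jacobi identity. -/
def jacobiator (p q r : ℤ) (a b c : RepAlg 𝒜 μ) : RepAlg 𝒜 μ :=
  ((p + n) * (r + n)).negOnePow • br a (br b c) +
    ((q + n) * (p + n)).negOnePow • br b (br c a) +
    ((r + n) * (q + n)).negOnePow • br c (br a b)

theorem jacobiator_cyclic (p q r : ℤ) (a b c : RepAlg 𝒜 μ) :
    jacobiator n br p q r a b c = jacobiator n br q r p b c a := by
  simp only [jacobiator]
  abel

/-- Antisymmetry moves `c` to the innermost right position in every term, which exhibits the Jacobi
form as an operator applied to `c`. -/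
theorem jacobiator_eq_smul (h : IsBiderivation (repGrading 𝒜 μ) n br) {p q r : ℤ}
    {a b c : RepAlg 𝒜 μ} (ha : a ∈ repGrading 𝒜 μ p) (hb : b ∈ repGrading 𝒜 μ q)
    (hc : c ∈ repGrading 𝒜 μ r) : jacobiator n br p q r a b c =
      ((p + n) * (r + n)).negOnePow • (br a ∘ₗ br b -
        ((p + n) * (q + n)).negOnePow • (br b ∘ₗ br a) - br (br a b)) c := by
  rw [jacobiator, h.antisymm r p c hc a ha, h.antisymm r _ c hc _ (h.graded p q a ha b hb)]
  simp only [LinearMap.sub_apply, LinearMap.comp_apply, LinearMap.smul_apply, smul_sub, smul_smul,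
    map_neg, linearMap_negOnePow_smul, smul_neg, ← Int.negOnePow_add]
  have s1 : ((q + n) * (p + n) + (r + n) * (p + n)).negOnePow =
      ((p + n) * (r + n) + (p + n) * (q + n)).negOnePow := negOnePow_congr 0 (by ring)
  have s2 : ((r + n) * (q + n) + (r + n) * (p + q + n + n)).negOnePow =
      ((p + n) * (r + n)).negOnePow := negOnePow_congr ((r + n) * (q + n)) (by ring)
  rw [s1, s2]
  abel

variable (𝒜 μ) in
/-- The linear map `(x ⊗ y ⊗ z, φ ⊗ ψ ⊗ χ) ↦ x_φ y_ψ z_χ`. -/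
def genMul₃ : A ⊗[K] (A ⊗[K] A) →ₗ[K] M ⊗[K] (M ⊗[K] M) →ₗ[K] RepAlg 𝒜 μ :=
  TensorProduct.curry (LinearMap.mul' K (RepAlg 𝒜 μ) ∘ₗ
    TensorProduct.map (gen 𝒜 μ) (genMul 𝒜 μ) ∘ₗ
    (TensorProduct.tensorTensorTensorComm K A (A ⊗[K] A) M (M ⊗[K] M)).toLinearMap)

theorem genMul₃_tmul (x y z : A) (φ ψ χ : M) :
    genMul₃ 𝒜 μ (x ⊗ₜ (y ⊗ₜ z)) (φ ⊗ₜ (ψ ⊗ₜ χ)) =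
      gen 𝒜 μ (x ⊗ₜ φ) * (gen 𝒜 μ (y ⊗ₜ ψ) * gen 𝒜 μ (z ⊗ₜ χ)) := by
  simp [genMul₃, genMul_tmul_tmul]

theorem genMul₃_assoc (W : A ⊗[K] A) (y : A) (S : M ⊗[K] M) (ψ : M) :
    genMul₃ 𝒜 μ (TensorProduct.assoc K A A A (W ⊗ₜ y))
      (TensorProduct.assoc K M M M (S ⊗ₜ ψ)) = genMul 𝒜 μ (W ⊗ₜ S) * gen 𝒜 μ (y ⊗ₜ ψ) := by
  induction W with
  | zero => simp
  | add x y hx hy => simp only [map_add, TensorProduct.add_tmul, hx, hy, LinearMap.add_apply,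
      add_mul]
  | tmul x z =>
    induction S with
    | zero => simp
    | add x y hx hy => simp only [map_add, TensorProduct.add_tmul, TensorProduct.tmul_add, hx, hy,
        add_mul]
    | tmul φ χ =>
      rw [TensorProduct.assoc_tmul, TensorProduct.assoc_tmul, genMul₃_tmul, genMul_tmul_tmul,
        mul_assoc]

variable [DirectSum.Decomposition 𝒜]

/-- The operator in `jacobiator_eq_smul` is a graded derivation, so its vanishing can be tested on
generators. -/
theorem jacobiator_eq_zero_of_gen (h : IsBiderivation (repGrading 𝒜 μ) n br) {p q : ℤ}
    {a b : RepAlg 𝒜 μ} (ha : a ∈ repGrading 𝒜 μ p) (hb : b ∈ repGrading 𝒜 μ q)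
    (hgen : ∀ r, ∀ c ∈ 𝒜 r, ∀ γ, jacobiator n br p q r a b (gen 𝒜 μ (c ⊗ₜ γ)) = 0)
    {r : ℤ} {c : RepAlg 𝒜 μ} (hc : c ∈ repGrading 𝒜 μ r) :
    jacobiator n br p q r a b c = 0 := by
  have hD : br a ∘ₗ br b - ((p + n) * (q + n)).negOnePow • (br b ∘ₗ br a) - br (br a b) ∈
      gradedDer 𝒜 μ (p + n + (q + n)) := by
    refine sub_mem (gradedDer_commutator (h.mem_gradedDer ha) (h.mem_gradedDer hb)) ?_
    have := h.mem_gradedDer (h.graded p q a ha b hb)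
    rwa [show p + q + n + n = p + n + (q + n) by ring] at this
  have := gradedDer_ext hD (zero_mem _) fun r c hc γ => by
    have := hgen r c hc γ
    rw [jacobiator_eq_smul h ha hb (gen_mem 𝒜 μ hc γ)] at this
    exact (smul_eq_zero_iff_eq _).mp this
  rw [jacobiator_eq_smul h ha hb hc, this]
  simp

/-- The sign of `P_{312}` is that of moving one generator past the other two in `A_M`, so rotating
the `A` factors amounts to rotating the `M` factors the other way. -/
theorem genMul₃_perm312 (W : A ⊗[K] (A ⊗[K] A)) (S : M ⊗[K] (M ⊗[K] M)) :
    genMul₃ 𝒜 μ (perm312 𝒜 0 W) S =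
      genMul₃ 𝒜 μ W (TensorProduct.assoc K M M M (TensorProduct.comm K M (M ⊗[K] M) S)) := by
  induction W with
  | zero => simp
  | add x y hx hy => simp only [map_add, LinearMap.add_apply, hx, hy]
  | tmul a W =>
    induction a using DirectSum.Decomposition.inductionOn 𝒜 with
    | zero => simp
    | add x y hx hy => simp only [TensorProduct.add_tmul, map_add, LinearMap.add_apply, hx, hy]
    | @homogeneous p a =>
      induction W using tensor_homogeneous_induction (𝒜 := 𝒜) with
      | zero => simp
      | add x y hx hy => simp only [TensorProduct.tmul_add, map_add, LinearMap.add_apply, hx, hy]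
      | tmul q r b hb c hc =>
        rw [perm312_tmul 𝒜 a.2 hb hc]
        induction S with
        | zero => simp
        | add x y hx hy => simp only [map_add, hx, hy]
        | tmul φ S =>
          induction S with
          | zero => simp
          | add x y hx hy => simp only [TensorProduct.tmul_add, map_add, hx, hy]
          | tmul ψ χ =>
            rw [linearMap_negOnePow_smul, LinearMap.smul_apply, TensorProduct.comm_tmul,
              TensorProduct.assoc_tmul, genMul₃_tmul, genMul₃_tmul, ← mul_assoc (gen 𝒜 μ (a ⊗ₜ ψ)),
              repGrading_comm 𝒜 μ (repGrading_mul 𝒜 μ (gen_mem 𝒜 μ a.2 ψ) (gen_mem 𝒜 μ hb χ))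
                (gen_mem 𝒜 μ hc φ)]
            congr 1
            exact negOnePow_congr 0 (by ring)

/-- The linear map `(db ⊗ id) (id ⊗ db)`. -/
def doubleComp (db : A ⊗[K] A →ₗ[K] A ⊗[K] A) :
    A ⊗[K] (A ⊗[K] A) →ₗ[K] A ⊗[K] (A ⊗[K] A) :=
  ((TensorProduct.assoc K A A A).toLinearMap ∘ₗ TensorProduct.map db LinearMap.id ∘ₗ
    (TensorProduct.assoc K A A A).symm.toLinearMap) ∘ₗ TensorProduct.map LinearMap.id db

theorem perm312_symm_tmul {n p q r : ℤ} {a b c : A} (ha : a ∈ 𝒜 p) (hb : b ∈ 𝒜 q)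
    (hc : c ∈ 𝒜 r) : (perm312 𝒜 n).symm (a ⊗ₜ (b ⊗ₜ c)) =
      ((p + n) * (q + n) + (p + n) * (r + n)).negOnePow • (b ⊗ₜ[K] (c ⊗ₜ[K] a)) := by
  rw [LinearEquiv.symm_apply_eq]
  refine Eq.symm ((linearMap_negOnePow_smul (perm312 𝒜 n).toLinearMap _ _).trans ?_)
  rw [LinearEquiv.coe_coe, perm312_tmul 𝒜 hb hc ha, smul_smul, ← Int.negOnePow_add,
    Int.negOnePow_even _ ⟨_, rfl⟩, one_smul]

variable {v : M ⊗[K] M →ₗ[K] K} {db : A ⊗[K] A →ₗ[K] A ⊗[K] A}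

/-- In `{a_α, x_φ y_ψ}` the summand with the bracket on `y_ψ` is commuted so that the bracket stands
first. Both summands then have the shape `(db ⊗ id)`, the second with its tensors flipped. -/
theorem bracket_gen_genMul (h : IsBiderivation (repGrading 𝒜 μ) n br)
    (hgen : IsInducedOnGen 𝒜 μ v db br) {p : ℤ} {a : A}
    (ha : a ∈ 𝒜 p) (α : M) (W : A ⊗[K] A) (S : M ⊗[K] M) :
    br (gen 𝒜 μ (a ⊗ₜ α)) (genMul 𝒜 μ (W ⊗ₜ S)) =
      genMul₃ 𝒜 μ (TensorProduct.assoc K A A A (TensorProduct.map db LinearMap.id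
        ((TensorProduct.assoc K A A A).symm (a ⊗ₜ W))))
        (TensorProduct.assoc K M M M (TensorProduct.map (vHat μ v ∘ₗ TensorProduct.mk K M M α)
          LinearMap.id S)) +
      genMul₃ 𝒜 μ (TensorProduct.assoc K A A A (TensorProduct.map db LinearMap.id
        ((TensorProduct.assoc K A A A).symm (a ⊗ₜ flip21 𝒜 0 W))))
        (TensorProduct.assoc K M M M (TensorProduct.map (vHat μ v ∘ₗ TensorProduct.mk K M M α)
          LinearMap.id (TensorProduct.comm K M M S))) := by
  induction W using tensor_homogeneous_induction (𝒜 := 𝒜) with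
  | zero => simp
  | add x y hx hy =>
    simp only [TensorProduct.add_tmul, TensorProduct.tmul_add, map_add, LinearMap.add_apply, hx, hy]
    abel
  | tmul q r x hx y hy =>
    induction S with
    | zero => simp
    | add x y hx hy =>
      simp only [TensorProduct.tmul_add, map_add, hx, hy]
      abel
    | tmul φ ψ =>
      have hY := repGrading_comm 𝒜 μ (gen_mem 𝒜 μ hx φ)
        (h.graded p r _ (gen_mem 𝒜 μ ha α) _ (gen_mem 𝒜 μ hy ψ))
      rw [genMul_tmul_tmul, h.leibniz_right p q r _ (gen_mem 𝒜 μ ha α) _ (gen_mem 𝒜 μ hx φ) _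
        (gen_mem 𝒜 μ hy ψ), hY, hgen, hgen, flip21_tmul 𝒜 hx hy, smul_smul, ← Int.negOnePow_add]
      congr 1
      · exact (genMul₃_assoc _ _ _ _).symm
      · have e : ∀ k : ℤ, ∀ z : A ⊗[K] A, TensorProduct.assoc K A A A
            (TensorProduct.map db LinearMap.id ((TensorProduct.assoc K A A A).symm
              (a ⊗ₜ (k.negOnePow • z)))) = k.negOnePow • TensorProduct.assoc K A A A
            (TensorProduct.map db LinearMap.id ((TensorProduct.assoc K A A A).symm (a ⊗ₜ z))) :=
          fun k z => linearMap_negOnePow_smul ((TensorProduct.assoc K A A A).toLinearMap ∘ₗ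
            TensorProduct.map db LinearMap.id ∘ₗ
              (TensorProduct.assoc K A A A).symm.toLinearMap ∘ₗ
                TensorProduct.mk K A (A ⊗[K] A) a) k z
        rw [e, linearMap_negOnePow_smul, LinearMap.smul_apply]
        congr 1
        · exact negOnePow_congr (q * (p + n)) (by ring)
        · exact (genMul₃_assoc _ _ _ _).symm

variable [IsScalarTower K A A] [SMulCommClass K A A]

/-- This is the vanishing tribracket evaluated in `A_M`: the inner permutations rotate `a, b, c`,
and the outer ones rotate `α, β, γ` by `genMul₃_perm312` and `vHat₃_cyclic`. -/
theorem doubleComp_cyclic_sum (hdb : IsDoubleGerstenhaber 𝒜 n db) (hμ : IsCoassoc μ)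
    (hv : IsCyclicForm μ v) {p q r : ℤ} {a b c : A} (ha : a ∈ 𝒜 p) (hb : b ∈ 𝒜 q)
    (hc : c ∈ 𝒜 r) (α β γ : M) :
    ((p + n) * (r + n)).negOnePow •
        genMul₃ 𝒜 μ (doubleComp db (a ⊗ₜ (b ⊗ₜ c))) (vHat₃ μ v α β γ) +
      ((q + n) * (p + n)).negOnePow •
        genMul₃ 𝒜 μ (doubleComp db (b ⊗ₜ (c ⊗ₜ a))) (vHat₃ μ v β γ α) +
      ((r + n) * (q + n)).negOnePow •
        genMul₃ 𝒜 μ (doubleComp db (c ⊗ₜ (a ⊗ₜ b))) (vHat₃ μ v γ α β) = 0 := by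
  have h0 : tribracket 𝒜 n db (a ⊗ₜ (b ⊗ₜ c)) =
      doubleComp db (a ⊗ₜ (b ⊗ₜ c)) +
      perm312 𝒜 0 (doubleComp db ((perm312 𝒜 n).symm (a ⊗ₜ (b ⊗ₜ c)))) +
      perm312 𝒜 0 (perm312 𝒜 0 (doubleComp db
        ((perm312 𝒜 n).symm ((perm312 𝒜 n).symm (a ⊗ₜ (b ⊗ₜ c)))))) := by
    rw [tribracket, Finset.sum_range_succ, Finset.sum_range_succ, Finset.sum_range_one, pow_zero,
      pow_zero, pow_one, pow_one, pow_two, pow_two]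
    rfl
  have h := congrArg (fun z => genMul₃ 𝒜 μ z (vHat₃ μ v α β γ)) h0
  have e : ∀ k : ℤ, ∀ x, (perm312 𝒜 n).symm (k.negOnePow • x) =
      k.negOnePow • (perm312 𝒜 n).symm x :=
    fun k x => linearMap_negOnePow_smul (perm312 𝒜 n).symm.toLinearMap k x
  have e' : ∀ k : ℤ, ∀ x, perm312 𝒜 0 (k.negOnePow • x) = k.negOnePow • perm312 𝒜 0 x :=
    fun k x => linearMap_negOnePow_smul (perm312 𝒜 0).toLinearMap k x
  simp only [hdb.tribracket_eq_zero, LinearMap.zero_apply, map_zero, map_add, LinearMap.add_apply,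
    perm312_symm_tmul ha hb hc, perm312_symm_tmul hb hc ha, e, e', linearMap_negOnePow_smul,
    LinearMap.smul_apply, genMul₃_perm312, ← vHat₃_cyclic hμ hv, smul_smul,
    ← Int.negOnePow_add] at h
  -- The factor `(-1)^(|a|_n |c|_n)` converts the signs of the permutations into those of the Jacobi
  -- form.
  have h' := congrArg (fun z => ((p + n) * (r + n)).negOnePow • z) h.symm
  simp only [smul_add, smul_smul, ← Int.negOnePow_add, smul_zero] at h'
  have s1 : ((p + n) * (r + n) + ((p + n) * (q + n) + (p + n) * (r + n))).negOnePow =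
      ((q + n) * (p + n)).negOnePow := negOnePow_congr ((p + n) * (r + n)) (by ring)
  have s2 : ((p + n) * (r + n) + ((p + n) * (q + n) + (p + n) * (r + n) +
      ((q + n) * (r + n) + (q + n) * (p + n)))).negOnePow = ((r + n) * (q + n)).negOnePow :=
    negOnePow_congr ((p + n) * (r + n) + (p + n) * (q + n)) (by ring)
  rwa [s1, s2] at h'

/-- The flipped summand of `bracket_gen_genMul` is rewritten by antisymmetry of the double bracket
and cyclicity of `v`, which exchange `b, β` with `c, γ`. -/
theorem bracket_gen_bracket_gen (hdb : IsDoubleBracket 𝒜 n db) (hv : IsCyclicForm μ v)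
    (h : IsBiderivation (repGrading 𝒜 μ) n br) (hgen : IsInducedOnGen 𝒜 μ v db br) {p q r : ℤ}
    {a b c : A} (ha : a ∈ 𝒜 p) (hb : b ∈ 𝒜 q) (hc : c ∈ 𝒜 r) (α β γ : M) :
    br (gen 𝒜 μ (a ⊗ₜ α)) (br (gen 𝒜 μ (b ⊗ₜ β)) (gen 𝒜 μ (c ⊗ₜ γ))) =
      genMul₃ 𝒜 μ (doubleComp db (a ⊗ₜ (b ⊗ₜ c))) (vHat₃ μ v α β γ) -
      ((q + n) * (r + n)).negOnePow •
        genMul₃ 𝒜 μ (doubleComp db (a ⊗ₜ (c ⊗ₜ b))) (vHat₃ μ v α γ β) := by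
  have hf := LinearMap.congr_fun hdb.antisymm (b ⊗ₜ c)
  simp only [LinearMap.comp_apply, LinearEquiv.coe_coe, flip21_tmul 𝒜 hb hc, LinearMap.neg_apply,
    linearMap_negOnePow_smul] at hf
  rw [hgen, bracket_gen_genMul h hgen ha, ← vHat_comm hv, ← neg_eq_iff_eq_neg.mpr hf,
    sub_eq_add_neg]
  congr 1
  have e : ∀ k : ℤ, ∀ W : A ⊗[K] A, TensorProduct.assoc K A A A
      (TensorProduct.map db LinearMap.id ((TensorProduct.assoc K A A A).symm
        (a ⊗ₜ (-(k.negOnePow • W))))) = -(k.negOnePow • TensorProduct.assoc K A A A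
      (TensorProduct.map db LinearMap.id ((TensorProduct.assoc K A A A).symm (a ⊗ₜ W)))) :=
    fun k W => (map_neg ((TensorProduct.assoc K A A A).toLinearMap ∘ₗ
      TensorProduct.map db LinearMap.id ∘ₗ (TensorProduct.assoc K A A A).symm.toLinearMap ∘ₗ
        TensorProduct.mk K A (A ⊗[K] A) a) _).trans
      (congrArg Neg.neg (linearMap_negOnePow_smul _ k W))
  rw [e, map_neg, linearMap_negOnePow_smul]
  rfl

theorem jacobiator_gen (hdb : IsDoubleGerstenhaber 𝒜 n db) (hμ : IsCoassoc μ)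
    (hv : IsCyclicForm μ v) (h : IsBiderivation (repGrading 𝒜 μ) n br)
    (hgen : IsInducedOnGen 𝒜 μ v db br) {p q r : ℤ}
    {a b c : A} (ha : a ∈ 𝒜 p) (hb : b ∈ 𝒜 q) (hc : c ∈ 𝒜 r) (α β γ : M) :
    jacobiator n br p q r (gen 𝒜 μ (a ⊗ₜ α)) (gen 𝒜 μ (b ⊗ₜ β)) (gen 𝒜 μ (c ⊗ₜ γ)) = 0 := by
  have h1 := doubleComp_cyclic_sum hdb hμ hv ha hb hc α β γ
  -- The negative terms form the cyclic sum for the opposite order `(a, c, b)`, up to the sign of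
  -- reversing three elements of these degrees.
  have h2 := congrArg (fun z => ((p + n) * (q + n) + (q + n) * (r + n) +
    (r + n) * (p + n)).negOnePow • z) (doubleComp_cyclic_sum hdb hμ hv ha hc hb α γ β)
  simp only [smul_add, smul_smul, ← Int.negOnePow_add, smul_zero] at h2
  rw [jacobiator, bracket_gen_bracket_gen hdb.toIsDoubleBracket hv h hgen ha hb hc,
    bracket_gen_bracket_gen hdb.toIsDoubleBracket hv h hgen hb hc ha,
    bracket_gen_bracket_gen hdb.toIsDoubleBracket hv h hgen hc ha hb]
  simp only [smul_sub, smul_smul, ← Int.negOnePow_add]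
  rw [← sub_eq_zero_of_eq (h1.trans h2.symm)]
  have s1 : ((p + n) * (r + n) + (q + n) * (r + n)).negOnePow =
      ((p + n) * (q + n) + (q + n) * (r + n) + (r + n) * (p + n) +
        (p + n) * (q + n)).negOnePow := negOnePow_congr (-((p + n) * (q + n))) (by ring)
  have s2 : ((q + n) * (p + n) + (r + n) * (p + n)).negOnePow =
      ((p + n) * (q + n) + (q + n) * (r + n) + (r + n) * (p + n) +
        (q + n) * (r + n)).negOnePow := negOnePow_congr (-((q + n) * (r + n))) (by ring)
  have s3 : ((r + n) * (q + n) + (p + n) * (q + n)).negOnePow =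
      ((p + n) * (q + n) + (q + n) * (r + n) + (r + n) * (p + n) +
        (r + n) * (p + n)).negOnePow := negOnePow_congr (-((r + n) * (p + n))) (by ring)
  rw [s1, s2, s3]
  abel

theorem isGerstenhaber_of_induced (hdb : IsDoubleGerstenhaber 𝒜 n db) (hμ : IsCoassoc μ)
    (hv : IsCyclicForm μ v) (h : IsBiderivation (repGrading 𝒜 μ) n br)
    (hgen : IsInducedOnGen 𝒜 μ v db br) : IsGerstenhaber (repGrading 𝒜 μ) n br := by
  refine ⟨h, fun p q r a ha b hb c hc => ?_⟩
  refine jacobiator_eq_zero_of_gen h ha hb (fun r c hc γ => ?_) hc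
  -- Rotating the arguments brings the next variable into the last slot, so each of the three is
  -- reduced to a generator in turn.
  rw [← jacobiator_cyclic]
  refine jacobiator_eq_zero_of_gen h (gen_mem 𝒜 μ hc γ) ha (fun q b hb β => ?_) hb
  rw [← jacobiator_cyclic]
  refine jacobiator_eq_zero_of_gen h (gen_mem 𝒜 μ hb β) (gen_mem 𝒜 μ hc γ)
    (fun p a ha α => ?_) ha
  exact jacobiator_gen hdb hμ hv h hgen hb hc ha β γ α

end Jacobi

/-! ### The non-graded case -/

section NonGraded

variable {K A M : Type*} [CommRing K] [NonUnitalRing A] [Module K A]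
  [AddCommGroup M] [Module K M]
variable {𝒜 : ℤ → Submodule K A} {μ : M →ₗ[K] M ⊗[K] M}

theorem eq_zero_or_of_degree_zero_eq_top {X : Type*} [AddCommGroup X] [Module K X]
    {𝒳 : ℤ → Submodule K X} [DirectSum.Decomposition 𝒳] (h0 : 𝒳 0 = ⊤) {p : ℤ} {a : X}
    (ha : a ∈ 𝒳 p) : p = 0 ∨ a = 0 := by
  by_contra! h
  exact h.1 (DirectSum.degree_eq_of_mem_mem 𝒳 ha (h0 ▸ Submodule.mem_top) h.2)

theorem repGrading_zero_eq_top (h0 : 𝒜 0 = ⊤) : repGrading 𝒜 μ 0 = ⊤ := by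
  rw [eq_top_iff]
  rintro x -
  induction x using repAlg_induction with
  | zero => exact zero_mem _
  | add x y hx hy => exact add_mem hx hy
  | smul k x hx => exact Submodule.smul_mem _ _ hx
  | mul x y hx hy => rw [← add_zero 0]; exact repGrading_mul 𝒜 μ hx hy
  | gen z =>
    induction z with
    | zero => simp
    | add x y hx hy => rw [map_add]; exact add_mem hx hy
    | tmul a α => exact gen_mem 𝒜 μ (h0 ▸ Submodule.mem_top) α

theorem mul_comm_of_degree_zero_eq_top (h0 : 𝒜 0 = ⊤) (x y : RepAlg 𝒜 μ) : x * y = y * x := by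
  have h := repGrading_zero_eq_top (μ := μ) h0
  simpa using repGrading_comm 𝒜 μ (p := 0) (q := 0) (x := x) (y := y) (by simp [h]) (by simp [h])

variable {br : RepAlg 𝒜 μ →ₗ[K] RepAlg 𝒜 μ →ₗ[K] RepAlg 𝒜 μ}

theorem IsGerstenhaber.isPoisson (h0 : 𝒜 0 = ⊤) (h : IsGerstenhaber (repGrading 𝒜 μ) 0 br) :
    IsPoisson br := by
  have hx : ∀ x, x ∈ repGrading 𝒜 μ 0 := fun x => by simp [repGrading_zero_eq_top h0]
  refine ⟨fun a b c => ?_, fun a b c => ?_, fun a b => ?_, fun a b c => ?_⟩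
  · simpa using h.leibniz_right 0 0 0 a (hx a) b (hx b) c (hx c)
  · simpa using h.leibniz_left 0 0 0 a (hx a) b (hx b) c (hx c)
  · simpa using h.antisymm 0 0 a (hx a) b (hx b)
  · simpa using h.jacobi 0 0 0 a (hx a) b (hx b) c (hx c)

/-- Nonzero homogeneous elements have degree zero, so all signs are trivial. This lets the
uniqueness of graded biderivations apply to Poisson brackets. -/
theorem IsPoisson.isBiderivation [DirectSum.Decomposition 𝒜] [IsScalarTower K A A]
    [SMulCommClass K A A] [SetLike.GradedMul 𝒜] (h0 : 𝒜 0 = ⊤) (h : IsPoisson br) :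
    IsBiderivation (repGrading 𝒜 μ) 0 br := by
  have hB := repGrading_zero_eq_top (μ := μ) h0
  let _ : DirectSum.Decomposition (repGrading 𝒜 μ) :=
    (repGrading_isInternal 𝒜 μ).chooseDecomposition
  refine ⟨fun p q a ha b hb => ?_, fun p q r a ha b hb c hc => ?_, fun p q r a ha b hb c hc => ?_,
    fun p q a ha b hb => ?_⟩
  · obtain rfl | rfl := eq_zero_or_of_degree_zero_eq_top hB ha
    · obtain rfl | rfl := eq_zero_or_of_degree_zero_eq_top hB hb
      · simp [hB]
      · simp
    · simp
  · rw [h.leibniz_right]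
    obtain rfl | rfl := eq_zero_or_of_degree_zero_eq_top hB ha <;> simp
  · rw [h.leibniz_left]
    obtain rfl | rfl := eq_zero_or_of_degree_zero_eq_top hB hb <;> simp
  · rw [h.antisymm]
    obtain rfl | rfl := eq_zero_or_of_degree_zero_eq_top hB ha <;> simp

end NonGraded

/-! ### The coalgebra of matrices and Van den Bergh's formula -/

section Matrices

variable {K : Type*} [CommRing K] {N : ℕ}

theorem matDual_eq_sum (f : MatDual K N) : f = ∑ i, ∑ j, evalE K N i j f • tau K N i j := by
  refine Matrix.ext_linearMap K fun i j => LinearMap.ext_ring ?_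
  simp [evalE, tau, Matrix.single_apply, ite_and]

theorem matDual_ext {X : Type*} [AddCommMonoid X] [Module K X] {f g : MatDual K N →ₗ[K] X}
    (h : ∀ i j, f (tau K N i j) = g (tau K N i j)) : f = g := by
  ext φ
  rw [matDual_eq_sum φ]
  simp [h]

theorem matComul_isCoassoc : IsCoassoc (matComul K N) := by
  refine matDual_ext fun i j => ?_
  simp only [LinearMap.comp_apply, matComul_tau, map_sum, TensorProduct.map_tmul,
    LinearMap.id_apply, TensorProduct.sum_tmul, TensorProduct.tmul_sum, LinearEquiv.coe_coe,
    TensorProduct.assoc_tmul]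
  exact Finset.sum_comm

/-- The iterated comultiplication of `τ_{k,l}` is the sum of `τ_{k,r} ⊗ τ_{r,s} ⊗ τ_{s,l}`, and the
trace form with `τ_{i,j}` keeps only `r = j`, `s = i`. -/
theorem vHat_traceForm (i j k l : Fin N) :
    vHat (matComul K N) (traceForm K N) (tau K N i j ⊗ₜ tau K N k l) =
      tau K N k j ⊗ₜ tau K N i l := by
  simp [vHat_tmul, matComul_tau, contract_tmul, traceForm_tau, ite_and, TensorProduct.tmul_ite]

theorem traceForm_isCyclicForm : IsCyclicForm (matComul K N) (traceForm K N) := by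
  apply TensorProduct.ext
  refine matDual_ext fun i j => matDual_ext fun k l => ?_
  simp [vHat_traceForm]

variable {A : Type*} [NonUnitalRing A] [Module K A] {𝒜 : ℤ → Submodule K A}

/-- Both sides of the bracket formula are bilinear in `α, β`, and the `τ_{i,j}` span the dual. -/
theorem isInducedOnGen_traceForm_iff {db : A ⊗[K] A →ₗ[K] A ⊗[K] A}
    {br : RepAlg 𝒜 (matComul K N) →ₗ[K] RepAlg 𝒜 (matComul K N) →ₗ[K]
      RepAlg 𝒜 (matComul K N)} :
    IsInducedOnGen 𝒜 (matComul K N) (traceForm K N) db br ↔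
      ∀ (a b : A) (i j k l : Fin N),
        br (gen 𝒜 (matComul K N) (a ⊗ₜ tau K N i j)) (gen 𝒜 (matComul K N) (b ⊗ₜ tau K N k l)) =
          genMul 𝒜 (matComul K N) (db (a ⊗ₜ b) ⊗ₜ (tau K N k j ⊗ₜ tau K N i l)) := by
  refine ⟨fun h a b i j k l => by rw [h, vHat_traceForm], fun h a b α β => ?_⟩
  have key : (br.compl₁₂ (gen 𝒜 (matComul K N) ∘ₗ TensorProduct.mk K A _ a)
      (gen 𝒜 (matComul K N) ∘ₗ TensorProduct.mk K A _ b)) =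
      (genBracket 𝒜 (matComul K N) (traceForm K N) db).compl₁₂ (TensorProduct.mk K A _ a)
        (TensorProduct.mk K A _ b) := by
    refine matDual_ext fun i j => matDual_ext fun k l => ?_
    refine (h a b i j k l).trans ?_
    rw [LinearMap.compl₁₂_apply, TensorProduct.mk_apply, TensorProduct.mk_apply, genBracket_tmul,
      vHat_traceForm]
  refine (LinearMap.congr_fun (LinearMap.congr_fun key α) β).trans ?_
  rw [LinearMap.compl₁₂_apply, TensorProduct.mk_apply, TensorProduct.mk_apply, genBracket_tmul]

variable (𝒜 N) in
/-- The universal representation `a ↦ (a_{i,j})`. -/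
def universalRep : A →ₙₐ[K] Matrix (Fin N) (Fin N) (RepAlg 𝒜 (matComul K N)) where
  toFun a := Matrix.of fun i j => gen 𝒜 (matComul K N) (a ⊗ₜ tau K N i j)
  map_smul' k a := by ext i j; simp [← TensorProduct.smul_tmul']
  map_zero' := by ext i j; simp
  map_add' a b := by ext i j; simp [TensorProduct.add_tmul]
  map_mul' a b := by
    ext i j
    simp [gen_mul, matComul_tau, Matrix.mul_apply]

theorem universalRep_apply (a : A) (i j : Fin N) :
    universalRep N 𝒜 a i j = gen 𝒜 (matComul K N) (a ⊗ₜ tau K N i j) := rfl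

/-- Sending `a_{i,j}` to the entry `s(a)_{i,j}` respects the relations: the multiplicative one is
matrix multiplication, and the commutation signs are trivial in degree zero. Uniqueness holds
because the `a_{i,j}` generate. -/
theorem existsUnique_universalRep_comp [DirectSum.Decomposition 𝒜] [IsScalarTower K A A]
    [SMulCommClass K A A] (h0 : 𝒜 0 = ⊤) {B : Type*} [NonUnitalCommRing B] [Module K B]
    [IsScalarTower K B B] [SMulCommClass K B B] (s : A →ₙₐ[K] Matrix (Fin N) (Fin N) B) :
    ∃! r : RepAlg 𝒜 (matComul K N) →ₙₐ[K] B, ∀ a i j, r (universalRep N 𝒜 a i j) = s a i j := by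
  let f : A ⊗[K] MatDual K N →ₗ[K] B := TensorProduct.lift <| ∑ i, ∑ j,
    (LinearMap.lsmul K B).flip.compl₁₂
      (Matrix.entryLinearMap K B i j ∘ₗ (s : A →ₗ[K] Matrix (Fin N) (Fin N) B)) (evalE K N i j)
  have hf : ∀ a i j, f (a ⊗ₜ tau K N i j) = s a i j := by
    intro a i j
    simp [f, evalE_tau, ite_and]
  obtain ⟨r, hr⟩ := exists_repAlg_lift 𝒜 (matComul K N) f (by
    intro p q a _ b _ α
    refine LinearMap.congr_fun (f := f ∘ₗ TensorProduct.mk K A _ (a * b))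
      (g := prodMap (f ∘ₗ TensorProduct.mk K A _ a) (f ∘ₗ TensorProduct.mk K A _ b) ∘ₗ
        matComul K N) (matDual_ext fun i j => ?_) α
    simp [matComul_tau, hf, Matrix.mul_apply]) (by
    intro p q a ha b hb α β
    obtain rfl | rfl := eq_zero_or_of_degree_zero_eq_top h0 ha
    · simp [mul_comm]
    · simp)
  refine ⟨r, fun a i j => by rw [universalRep_apply, hr, hf], fun r' hr' => ?_⟩
  refine repAlg_hom_ext 𝒜 (matComul K N) fun z => ?_
  refine LinearMap.congr_fun (f := (r' : RepAlg 𝒜 (matComul K N) →ₗ[K] B) ∘ₗ gen 𝒜 (matComul K N))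
    (g := (r : RepAlg 𝒜 (matComul K N) →ₗ[K] B) ∘ₗ gen 𝒜 (matComul K N))
    (TensorProduct.ext (LinearMap.ext fun a => matDual_ext fun i j => ?_)) z
  refine (hr' a i j).trans ?_
  rw [← hf, ← hr]
  rfl

end Matrices

end RepBracket

end

/-! ### Assembly of the theorem -/

theorem mainTheorem1 {K A M : Type*} [CommRing K]
    [NonUnitalRing A] [Module K A] [IsScalarTower K A A] [SMulCommClass K A A]
    [AddCommGroup M] [Module K M]
    (𝒜 : ℤ → Submodule K A) [DirectSum.Decomposition 𝒜] [SetLike.GradedMul 𝒜]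
    (n : ℤ) (db : A ⊗[K] A →ₗ[K] A ⊗[K] A) (hdb : IsDoubleBracket 𝒜 n db)
    (μ : M →ₗ[K] M ⊗[K] M) (hμ : IsCoassoc μ)
    (v : M ⊗[K] M →ₗ[K] K) (hv : IsCyclicForm μ v) :
    -- the representation algebra is a commutative graded algebra
    (DirectSum.IsInternal (repGrading 𝒜 μ) ∧ SetLike.GradedMul (repGrading 𝒜 μ) ∧
      ∀ p q : ℤ, ∀ x ∈ repGrading 𝒜 μ p, ∀ y ∈ repGrading 𝒜 μ q,
        x * y = (p * q).negOnePow • (y * x)) ∧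
    -- the induced biderivation exists and is unique
    (∃! br : RepAlg 𝒜 μ →ₗ[K] RepAlg 𝒜 μ →ₗ[K] RepAlg 𝒜 μ,
      IsBiderivation (repGrading 𝒜 μ) n br ∧ IsInducedOnGen 𝒜 μ v db br) ∧
    -- it is a Gerstenhaber bracket if the double bracket is Gerstenhaber
    (IsDoubleGerstenhaber 𝒜 n db →
      ∀ br : RepAlg 𝒜 μ →ₗ[K] RepAlg 𝒜 μ →ₗ[K] RepAlg 𝒜 μ,
        IsBiderivation (repGrading 𝒜 μ) n br → IsInducedOnGen 𝒜 μ v db br →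
        IsGerstenhaber (repGrading 𝒜 μ) n br) ∧
    -- the non-graded case: double Poisson brackets induce Poisson brackets
    (𝒜 0 = ⊤ → n = 0 → IsDoubleGerstenhaber 𝒜 n db →
      (∀ x y : RepAlg 𝒜 μ, x * y = y * x) ∧
      ∃! br : RepAlg 𝒜 μ →ₗ[K] RepAlg 𝒜 μ →ₗ[K] RepAlg 𝒜 μ,
        IsPoisson br ∧ IsInducedOnGen 𝒜 μ v db br) ∧
    -- the coalgebra dual to `N × N` matrices with the trace form: the induced bracket is given by
    -- Van den Bergh's formula, and for non-graded `A` the algebra is the coordinate algebra of the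
    -- variety of `N`-dimensional representations
    (∀ N : ℕ, 1 ≤ N →
      IsCoassoc (matComul K N) ∧ IsCyclicForm (matComul K N) (traceForm K N) ∧
      (∀ br : RepAlg 𝒜 (matComul K N) →ₗ[K] RepAlg 𝒜 (matComul K N) →ₗ[K]
          RepAlg 𝒜 (matComul K N),
        IsInducedOnGen 𝒜 (matComul K N) (traceForm K N) db br ↔
          ∀ (a b : A) (i j k l : Fin N),
            br (gen 𝒜 (matComul K N) (a ⊗ₜ tau K N i j))
                (gen 𝒜 (matComul K N) (b ⊗ₜ tau K N k l)) =
              genMul 𝒜 (matComul K N) (db (a ⊗ₜ b) ⊗ₜ (tau K N k j ⊗ₜ tau K N i l))) ∧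
      (𝒜 0 = ⊤ →
        ∃ t : A →ₙₐ[K] Matrix (Fin N) (Fin N) (RepAlg 𝒜 (matComul K N)),
          (∀ a i j, t a i j = gen 𝒜 (matComul K N) (a ⊗ₜ tau K N i j)) ∧
          ∀ (B : Type*) [NonUnitalCommRing B] [Module K B] [IsScalarTower K B B]
            [SMulCommClass K B B] (s : A →ₙₐ[K] Matrix (Fin N) (Fin N) B),
            ∃! r : RepAlg 𝒜 (matComul K N) →ₙₐ[K] B, ∀ a i j, r (t a i j) = s a i j)) := by
  refine ⟨⟨repGrading_isInternal 𝒜 μ, inferInstance, fun p q x hx y hy =>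
    repGrading_comm 𝒜 μ hx hy⟩, ?_, fun hG br h hgen => isGerstenhaber_of_induced hG hμ hv h hgen,
    ?_, fun N _ => ⟨matComul_isCoassoc, traceForm_isCyclicForm,
      fun br => isInducedOnGen_traceForm_iff, fun h0 => ⟨universalRep N 𝒜, fun a i j => rfl, ?_⟩⟩⟩
  · obtain ⟨br, h, hgen⟩ := exists_induced_bracket hdb hμ hv
    exact ⟨br, ⟨h, hgen⟩, fun br' ⟨h', hgen'⟩ => h'.ext h fun p q a _ b _ α β => by
      rw [hgen, hgen']⟩
  · rintro h0 rfl hG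
    obtain ⟨br, h, hgen⟩ := exists_induced_bracket hdb hμ hv
    refine ⟨mul_comm_of_degree_zero_eq_top h0, br,
      ⟨(isGerstenhaber_of_induced hG hμ hv h hgen).isPoisson h0, hgen⟩, fun br' ⟨h', hgen'⟩ =>
        (h'.isBiderivation h0).ext h fun p q a _ b _ α β => by rw [hgen, hgen']⟩
  · intro B _ _ _ _ s
    exact existsUnique_universalRep_comp h0 s
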